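/- Let $\mathbb{F}$ be a field of prime characteristic $p$, let $L$ be a finite-dimensional Lie algebra over $\mathbb{F}$, and let $M$ be a finite-dimensional $L$-module with representation $\rho:L\to\mathfrak{gl}(M)$. Let $(\mathfrak{L},(\cdot)^{[p]},\iota)$ be a $p$-envelope of $L$, i.e., $\mathfrak{L}$ is a restricted Lie algebra over $\mathbb{F}$ with $p$-mapping $(\cdot)^{[p]}$, and $\iota:L\to\mathfrak{L}$ is an injective Lie algebra homomorphism such that the smallest subalgebra of $\mathfrak{L}$ that contains $\iota(L)$ and is closed under $(\cdot)^{[p]}$ is $\mathfrak{L}$ itself. Suppose that $k:=\dim_{\mathbb{F}}\mathfrak{L}/\iota(L)<\infty$. Let $\hat{L}$ be the universal $p$-envelope of $L$, i.e., the smallest Lie subalgebra of the universal enveloping algebra $U(L)$ that contains the image of $L$ and is closed under $u\mapsto u^p$, let $\hat{\iota}:L\to\hat{L}$ be the canonical homomorphism, and let $\hat{\rho}:\hat{L}\to\mathfrak{gl}(M)$ be the restriction to $\hat{L}$ of the algebra homomorphism $U(L)\to\mathrm{End}_{\mathbb{F}}(M)$ extending $\rho$. Let $\phi:\mathfrak{L}\to\hat{L}$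 be any Lie algebra homomorphism with $\phi\circ\iota=\hat{\iota}$, and regard $M$ as an $\mathfrak{L}$-module via $\hat{\rho}\circ\phi$ (a representation of $\mathfrak{L}$ that extends $\rho$). Let $H^n(L,M)$ and $H^n(\mathfrak{L},M)$ denote the ordinary (Chevalley–Eilenberg) cohomology spaces, with $H^n=0$ for $n<0$. Then, for every non-negative integer $n$, these spaces are finite-dimensional and $$\dim_{\mathbb{F}}H^n(\mathfrak{L},M)=\sum_{j=0}^{k}\binom{k}{j}\dim_{\mathbb{F}}H^{n-j}(L,M),$$ $$\dim_{\mathbb{F}}H^n(L,M)=\sum_{\nu=0}^{n}(-1)^{\nu}\binom{\nu+k-1}{k-1}\dim_{\mathbb{F}}H^{n-\nu}(\mathfrak{L},M),$$ where for $k=0$ the convention $\binom{-1}{-1}=1$ and $\binom{\nu-1}{-1}=0$ for $\nu\ge 1$ is used. -/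

import Mathlib

open scoped TensorProduct Polynomial

attribute [local instance 100] LieRing.ofAssociativeRing

/-! ### Chevalley–Eilenberg cohomology -/

namespace ChevalleyEilenberg

variable {F L M : Type*} [Field F] [LieRing L] [LieAlgebra F L] [AddCommGroup M] [Module F M]

/-- The Chevalley–Eilenberg coboundary formula for the representation `ρ` of `L` on `M`:
`(df)(x₀, …, xₙ)` is
`∑ᵢ (-1)ⁱ (xᵢ · f(x₀, …, x̂ᵢ, …, xₙ) - ∑_{j > i} f(x₀, …, x̂ᵢ, …, [xᵢ, xⱼ], …, xₙ))`,
where `[xᵢ, xⱼ]` stands at the place of `xⱼ`. As `f` is alternating, moving `[xᵢ, xⱼ]` to the first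
place gives the usual term `∑_{i < j} (-1)^(i+j) f([xᵢ, xⱼ], x₀, …, x̂ᵢ, …, x̂ⱼ, …, xₙ)`. -/
def coboundaryFormula (ρ : L →ₗ⁅F⁆ Module.End F M) {n : ℕ} (f : L [⋀^Fin n]→ₗ[F] M)
    (v : Fin (n + 1) → L) : M :=
  ∑ i : Fin (n + 1), (-1 : ℤ) ^ (i : ℕ) •
    (ρ (v i) (f (i.removeNth v)) -
      ∑ j ∈ Finset.Ioi i, f (i.removeNth (Function.update v j ⁅v i, v j⁆)))

/-- The multilinear map underlying the Lie derivative of a cochain. -/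
def lieDeriv (ρ : L →ₗ⁅F⁆ Module.End F M) {n : ℕ} (x : L) (f : L [⋀^Fin n]→ₗ[F] M) :
    MultilinearMap F (fun _ : Fin n => L) M :=
  (ρ x).compMultilinearMap f.toMultilinearMap -
    ∑ k : Fin n, f.toMultilinearMap.compLinearMap
      (fun j => if j = k then (LieAlgebra.ad F L x : L →ₗ[F] L) else LinearMap.id)

theorem lieDeriv_apply (ρ : L →ₗ⁅F⁆ Module.End F M) {n : ℕ} (x : L) (f : L [⋀^Fin n]→ₗ[F] M)
    (v : Fin n → L) :
    lieDeriv ρ x f v = ρ x (f v) - ∑ k : Fin n, f (Function.update v k ⁅x, v k⁆) := by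
  simp only [lieDeriv, sub_apply, sum_apply]
  congr 1
  refine Finset.sum_congr rfl fun k _ => ?_
  rw [MultilinearMap.compLinearMap_apply]
  refine congrArg f (funext fun j => ?_)
  by_cases h : j = k
  · subst h; simp
  · simp [h]

theorem succ_removeNth_cons {L : Type*} {n : ℕ} (i : Fin (n + 1)) (x : L) (w : Fin (n + 1) → L) :
    i.succ.removeNth (Fin.cons x w : Fin (n + 2) → L) = Fin.cons x (i.removeNth w) := by
  funext j
  refine Fin.cases ?_ (fun j => ?_) j <;> simp [Fin.removeNth]

theorem coboundaryFormula_cons (ρ : L →ₗ⁅F⁆ Module.End F M) {n : ℕ}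
    (f : L [⋀^Fin (n + 1)]→ₗ[F] M) (x : L) (w : Fin (n + 1) → L) :
    coboundaryFormula ρ f (Fin.cons x w) =
      lieDeriv ρ x f w - coboundaryFormula ρ (f.curryLeft x) w := by
  rw [coboundaryFormula, Fin.sum_univ_succ, lieDeriv_apply, coboundaryFormula,
    sub_eq_add_neg _ (∑ i, _), ← Finset.sum_neg_distrib]
  congr 1
  · rw [Fin.sum_Ioi_zero]
    simp [← Fin.cons_update]
  · refine Finset.sum_congr rfl fun i _ => ?_
    rw [Fin.sum_Ioi_succ]
    simp only [Fin.val_succ, pow_succ, Fin.cons_succ, ← Fin.cons_update, succ_removeNth_cons,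
      AlternatingMap.curryLeft_apply_apply, Matrix.vecCons, mul_neg, mul_one, neg_smul]

theorem coboundaryFormula_add (ρ : L →ₗ⁅F⁆ Module.End F M) {n : ℕ} (f g : L [⋀^Fin n]→ₗ[F] M)
    (v : Fin (n + 1) → L) :
    coboundaryFormula ρ (f + g) v = coboundaryFormula ρ f v + coboundaryFormula ρ g v := by
  simp only [coboundaryFormula, ← Finset.sum_add_distrib, ← smul_add]
  refine Finset.sum_congr rfl fun i _ => ?_
  simp only [AlternatingMap.add_apply, map_add, Finset.sum_add_distrib]
  congr 1
  abel

theorem coboundaryFormula_smul (ρ : L →ₗ⁅F⁆ Module.End F M) {n : ℕ} (c : F)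
    (f : L [⋀^Fin n]→ₗ[F] M) (v : Fin (n + 1) → L) :
    coboundaryFormula ρ (c • f) v = c • coboundaryFormula ρ f v := by
  simp only [coboundaryFormula, Finset.smul_sum]
  refine Finset.sum_congr rfl fun i _ => ?_
  simp only [AlternatingMap.smul_apply, map_smul, ← Finset.smul_sum, ← smul_sub]
  rw [smul_comm]

theorem lieDeriv_eq_zero (ρ : L →ₗ⁅F⁆ Module.End F M) {n : ℕ} (x : L) (f : L [⋀^Fin n]→ₗ[F] M)
    (v : Fin n → L) {a b : Fin n} (hv : v a = v b) (hab : a ≠ b) : lieDeriv ρ x f v = 0 := by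
  rw [lieDeriv_apply, f.map_eq_zero_of_eq v hv hab, map_zero, zero_sub, neg_eq_zero,
    Fintype.sum_eq_add a b hab]
  · have h := f.map_swap (Function.update v b ⁅x, v b⁆) hab
    rw [add_eq_zero_iff_eq_neg, ← h]
    refine congrArg f (funext fun j => ?_)
    by_cases ha : j = a
    · subst ha; simp [hv]
    · by_cases hb : j = b
      · subst hb; simp [hv, hab, hab.symm]
      · simp [Equiv.swap_apply_of_ne_of_ne ha hb, ha, hb]
  · rintro k ⟨hka, hkb⟩
    exact f.map_eq_zero_of_eq _ (by simp [hka.symm, hkb.symm, hv]) hab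

theorem lieDeriv_cons_self (ρ : L →ₗ⁅F⁆ Module.End F M) {n : ℕ} (x : L)
    (f : L [⋀^Fin (n + 1)]→ₗ[F] M) (w : Fin n → L) :
    lieDeriv ρ x f (Fin.cons x w) = lieDeriv ρ x (f.curryLeft x) w := by
  rw [lieDeriv_apply, lieDeriv_apply, Fin.sum_univ_succ]
  rw [f.map_coord_zero (m := Function.update _ 0 _) 0 (by simp)]
  simp [← Fin.cons_update, Matrix.vecCons]

/-- The coboundary of an alternating map is an alternating map. -/
theorem exists_alternatingMap_eq_coboundaryFormula (n : ℕ) : ∀ f : L [⋀^Fin n]→ₗ[F] M, ∀ ρ : L →ₗ⁅F⁆ Module.End F M,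
    ∃ A : L [⋀^Fin (n + 1)]→ₗ[F] M, ∀ v, A v = coboundaryFormula ρ f v := by
  induction n with
  | zero =>
    intro f ρ
    refine ⟨AlternatingMap.alternatizeUncurryFin
      { toFun := fun x => (ρ x).compAlternatingMap f
        map_add' := fun x y => by ext; simp
        map_smul' := fun c x => by ext; simp }, fun v => ?_⟩
    rw [AlternatingMap.alternatizeUncurryFin_apply]
    simp [coboundaryFormula]
  | succ n ih =>
    intro f ρ
    choose A hA using fun x => ih (f.curryLeft x) ρ
    let g : L →ₗ[F] MultilinearMap F (fun _ : Fin (n + 1) => L) M :=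
      { toFun := fun x => lieDeriv ρ x f - (A x).toMultilinearMap
        map_add' := fun x y => by
          ext w
          have h : A (x + y) w = A x w + A y w := by
            rw [hA, hA, hA, map_add, coboundaryFormula_add]
          simp only [sub_apply, add_apply, AlternatingMap.coe_multilinearMap, h, lieDeriv_apply,
            map_add, add_lie, AlternatingMap.map_update_add, Finset.sum_add_distrib,
            LinearMap.add_apply]
          abel
        map_smul' := fun c x => by
          ext w
          have h : A (c • x) w = c • A x w := by
            rw [hA, hA, map_smul, coboundaryFormula_smul]
          simp only [sub_apply, smul_apply, AlternatingMap.coe_multilinearMap, h, lieDeriv_apply,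
            map_smul, smul_lie, AlternatingMap.map_update_smul, ← Finset.smul_sum,
            LinearMap.smul_apply, smul_sub, RingHom.id_apply] }
    let B : MultilinearMap F (fun _ : Fin (n + 2) => L) M :=
      LinearMap.uncurryLeft (M := fun _ : Fin (n + 2) => L) g
    have hg : ∀ x w, g x w = coboundaryFormula ρ f (Fin.cons x w) := fun x w => by
      rw [coboundaryFormula_cons, ← hA]
      rfl
    have hB : ∀ v, B v = coboundaryFormula ρ f v := fun v => by
      rw [← Fin.cons_self_tail v, ← hg]
      rfl
    have htail : ∀ x (w : Fin (n + 1) → L) (a b : Fin (n + 1)), w a = w b → a ≠ b →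
        g x w = 0 := fun x w a b hw hab => by
      rw [hg, coboundaryFormula_cons, ← hA, lieDeriv_eq_zero ρ x f w hw hab,
        (A x).map_eq_zero_of_eq w hw hab, sub_zero]
    have h0 : ∀ x (w : Fin n → L), g x (Fin.cons x w) = 0 := by
      intro x w
      rw [hg, coboundaryFormula_cons, lieDeriv_cons_self]
      cases n with
      | zero => simp [coboundaryFormula, lieDeriv_apply]
      | succ n =>
        have h : (f.curryLeft x).curryLeft x = 0 := by
          ext u
          exact f.map_eq_zero_of_eq _ (i := 0) (j := 1) rfl (by simp)
        rw [coboundaryFormula_cons, h]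
        simp [coboundaryFormula]
    have hhead : ∀ x (w : Fin (n + 1) → L) (b : Fin (n + 1)), x = w b → g x w = 0 := by
      intro x w b hw
      let gx : L [⋀^Fin (n + 1)]→ₗ[F] M := { g x with map_eq_zero_of_eq' := htail x }
      have h1 : g x (w ∘ Equiv.swap 0 b) = 0 := by
        rw [← Fin.cons_self_tail (w ∘ Equiv.swap 0 b)]
        simpa [← hw] using h0 x (Fin.tail (w ∘ Equiv.swap 0 b))
      by_cases hb : 0 = b
      · subst hb
        simpa using h1
      · exact neg_eq_zero.1 ((gx.map_swap w hb).symm.trans h1)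
    refine ⟨{ B with map_eq_zero_of_eq' := ?_ }, hB⟩
    intro v a b hv hab
    change g (v 0) (Fin.tail v) = 0
    induction a using Fin.cases with
    | zero =>
      induction b using Fin.cases with
      | zero => exact absurd rfl hab
      | succ b => exact hhead _ _ b hv
    | succ a =>
      induction b using Fin.cases with
      | zero => exact hhead _ _ a hv.symm
      | succ b => exact htail _ _ a b hv (fun h => hab (by rw [h]))

/-- The Chevalley–Eilenberg differential `Cⁿ(L, M) → Cⁿ⁺¹(L, M)`, where `Cⁿ(L, M)` is the space of
alternating `n`-linear maps from `L` to `M`. -/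
def d (ρ : L →ₗ⁅F⁆ Module.End F M) (n : ℕ) :
    L [⋀^Fin n]→ₗ[F] M →ₗ[F] L [⋀^Fin (n + 1)]→ₗ[F] M where
  toFun f :=
    { toFun := coboundaryFormula ρ f
      map_update_add' := by
        intro inst v i x y
        obtain ⟨A, hA⟩ := exists_alternatingMap_eq_coboundaryFormula n f ρ
        rw [← hA, ← hA, ← hA]
        rw [Subsingleton.elim inst (instDecidableEqFin (n + 1)), A.map_update_add]
      map_update_smul' := by
        intro inst v i c x
        obtain ⟨A, hA⟩ := exists_alternatingMap_eq_coboundaryFormula n f ρ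
        rw [← hA, ← hA]
        rw [Subsingleton.elim inst (instDecidableEqFin (n + 1)), A.map_update_smul]
      map_eq_zero_of_eq' := by
        intro v i j hv hij
        obtain ⟨A, hA⟩ := exists_alternatingMap_eq_coboundaryFormula n f ρ
        have h := A.map_eq_zero_of_eq v hv hij
        rwa [hA] at h }
  map_add' f g := by
    ext v
    exact coboundaryFormula_add ρ f g v
  map_smul' c f := by
    ext v
    exact coboundaryFormula_smul ρ c f v

/-- The space `Zⁿ(L, M)` of `n`-cocycles. -/
def cocycles (ρ : L →ₗ⁅F⁆ Module.End F M) (n : ℕ) : Submodule F (L [⋀^Fin n]→ₗ[F] M) :=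
  LinearMap.ker (d ρ n)

/-- The space `Bⁿ(L, M)` of `n`-coboundaries, with `B⁰(L, M) = 0`. -/
def coboundaries (ρ : L →ₗ⁅F⁆ Module.End F M) : (n : ℕ) → Submodule F (L [⋀^Fin n]→ₗ[F] M)
  | 0 => ⊥
  | n + 1 => LinearMap.range (d ρ n)

/-- The cohomology space `Hⁿ(L, M) = Zⁿ(L, M) / Bⁿ(L, M)`. -/
abbrev Cohomology (ρ : L →ₗ⁅F⁆ Module.End F M) (n : ℕ) : Type _ :=
  cocycles ρ n ⧸ (coboundaries ρ n).submoduleOf (cocycles ρ n)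

end ChevalleyEilenberg

/-! ### Restricted Lie algebras and `p`-envelopes -/

section Restricted

variable (p : ℕ) (F : Type*) [Field F]

/-- For `a, b` in a Lie algebra `L` over a field of characteristic `p`, the element `sᵢ(a, b)`
(`1 ≤ i ≤ p - 1`) is determined by
`(ad (X ⊗ a + 1 ⊗ b))^(p-1) (1 ⊗ a) = ∑ᵢ i X^(i-1) ⊗ sᵢ(a, b)` in `F[X] ⊗ L`. -/
noncomputable def jacobsonTerm {L : Type*} [LieRing L] [LieAlgebra F L] (a b : L) (i : ℕ) : L :=
  (i : F)⁻¹ • TensorProduct.lid F L (((Polynomial.lcoeff F (i - 1)).rTensor L)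
    (((LieAlgebra.ad F[X] (F[X] ⊗[F] L)
      ((Polynomial.X : F[X]) ⊗ₜ[F] a + (1 : F[X]) ⊗ₜ[F] b)) ^ (p - 1)) ((1 : F[X]) ⊗ₜ[F] a)))

/-- A `p`-mapping on a Lie algebra `L`; the pair of `L` and a `p`-mapping on it is a restricted Lie
algebra. -/
structure PMapping (L : Type*) [LieRing L] [LieAlgebra F L] where
  /-- the map `x ↦ x^[p]` -/
  toFun : L → L
  ad_toFun : ∀ x, LieAlgebra.ad F L (toFun x) = LieAlgebra.ad F L x ^ p
  toFun_smul : ∀ (c : F) (x : L), toFun (c • x) = c ^ p • toFun x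
  toFun_add : ∀ x y : L, toFun (x + y) =
    toFun x + toFun y + ∑ i ∈ Finset.Icc 1 (p - 1), jacobsonTerm p F x y i

/-- The smallest Lie subalgebra that contains `S` and is closed under the map `P`. For a `p`-mapping
`P` this is the restricted subalgebra generated by `S`. -/
def restrictedSpan {F : Type*} [Field F] {L : Type*} [LieRing L] [LieAlgebra F L]
    (P : L → L) (S : Set L) : LieSubalgebra F L :=
  sInf {H : LieSubalgebra F L | S ⊆ H ∧ ∀ x ∈ H, P x ∈ H}

/-- The restricted Lie algebra `E` with `p`-mapping `P`, together with `ι : L → E`, is a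
`p`-envelope of `L`. -/
structure IsPEnvelope {p : ℕ} {F : Type*} [Field F] {L E : Type*} [LieRing L] [LieAlgebra F L]
    [LieRing E] [LieAlgebra F E] (P : PMapping p F E) (ι : L →ₗ⁅F⁆ E) : Prop where
  injective : Function.Injective ι
  restrictedSpan_eq_top : restrictedSpan (F := F) P.toFun (Set.range ι) = ⊤

/-- The universal `p`-envelope of `L`: the smallest Lie subalgebra of the universal enveloping
algebra that contains the image of `L` and is closed under `u ↦ u ^ p`. -/
def UniversalPEnvelope (L : Type*) [LieRing L] [LieAlgebra F L] :
    LieSubalgebra F (UniversalEnvelopingAlgebra F L) :=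
  restrictedSpan (fun u => u ^ p) (Set.range (UniversalEnvelopingAlgebra.ι F (L := L)))

end Restricted

namespace UniversalPEnvelope

variable (p : ℕ) {F : Type*} [Field F] {L M : Type*} [LieRing L] [LieAlgebra F L]
  [AddCommGroup M] [Module F M]

theorem ι_mem (x : L) : UniversalEnvelopingAlgebra.ι F x ∈ UniversalPEnvelope p F L := by
  rw [UniversalPEnvelope, restrictedSpan, ← SetLike.mem_coe, LieSubalgebra.coe_sInf]
  exact Set.mem_iInter₂.2 fun H hH => hH.1 ⟨x, rfl⟩

theorem pow_mem {u : UniversalEnvelopingAlgebra F L} (hu : u ∈ UniversalPEnvelope p F L) :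
    u ^ p ∈ UniversalPEnvelope p F L := by
  rw [UniversalPEnvelope, restrictedSpan, ← SetLike.mem_coe, LieSubalgebra.coe_sInf] at hu ⊢
  exact Set.mem_iInter₂.2 fun H hH => hH.2 u (Set.mem_iInter₂.1 hu H hH)

variable (F L) in
/-- The canonical homomorphism from `L` to its universal `p`-envelope. -/
def ι : L →ₗ⁅F⁆ UniversalPEnvelope p F L :=
  { toFun := fun x => ⟨UniversalEnvelopingAlgebra.ι F x, ι_mem p x⟩
    map_add' := fun x y => Subtype.ext (map_add _ x y)
    map_smul' := fun c x => Subtype.ext (map_smul _ c x)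
    map_lie' := fun {x y} => Subtype.ext (LieHom.map_lie _ x y) }

/-- The extension of a representation `ρ` of `L` to the restricted representation of the universal
`p`-envelope of `L`: the restriction of the homomorphism that `ρ` induces on the universal
enveloping algebra. -/
noncomputable def rep (ρ : L →ₗ⁅F⁆ Module.End F M) :
    UniversalPEnvelope p F L →ₗ⁅F⁆ Module.End F M :=
  ((UniversalEnvelopingAlgebra.lift F ρ : UniversalEnvelopingAlgebra F L →ₐ[F] Module.End F M) :
    UniversalEnvelopingAlgebra F L →ₗ⁅F⁆ Module.End F M).comp (UniversalPEnvelope p F L).incl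

/-- `rep` extends `ρ`. -/
theorem rep_comp_ι (ρ : L →ₗ⁅F⁆ Module.End F M) : (rep p ρ).comp (ι p F L) = ρ := by
  ext1 x
  exact UniversalEnvelopingAlgebra.lift_ι_apply F ρ x

/-- `rep` maps `p`-th powers to `p`-th powers. -/
theorem rep_pow (ρ : L →ₗ⁅F⁆ Module.End F M) (u : UniversalPEnvelope p F L) :
    rep p ρ ⟨(u : UniversalEnvelopingAlgebra F L) ^ p, pow_mem p u.2⟩ = rep p ρ u ^ p :=
  map_pow (UniversalEnvelopingAlgebra.lift F ρ) (u : UniversalEnvelopingAlgebra F L) p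

end UniversalPEnvelope

/-- The binomial coefficient `C(ν + k - 1, k - 1)`, with the usual convention for `k = 0`:
`C(-1, -1) = 1` and `C(ν - 1, -1) = 0` for `ν ≥ 1`. -/
def shiftedChoose (ν k : ℕ) : ℕ :=
  if k = 0 then (if ν = 0 then 1 else 0) else (ν + k - 1).choose (k - 1)

/-! The derived algebra of a `p`-envelope `E` lies in `L` (`IsPEnvelope.lie_mem_range`), so every
subspace between `L` and `E` is an ideal, and `E` is reached from `L` in `k` steps of codimension
one. For a step `G = H ⊕ F x`, a cochain on `G` is a pair of cochains on `H`, and in the resulting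
long exact sequence the connecting map is, up to sign, the action of `x` on the cohomology of `H`.
If this action is zero, then `bₙ(G) = bₙ(H) + bₙ₋₁(H)` (`betti_of_actsTrivially`), so the step
multiplies the Poincaré series by `1 + X`. Both formulas compare coefficients in `P_E = (1 + X)ᵏ
P_L`, the second after inverting `(1 + X)ᵏ`.

The action is zero for the following reason. Consider the elements of `U(L)` that act compatibly on
`H` and on `M` and induce zero on the cohomology of `H`. They form a Lie subalgebra. It contains `L`
by Cartan's formula, and it is closed under `p`-th powers because in characteristic `p` the `p`-th
power of the operator of a pair `(D, T)` on cochains is the operator of `(D ^ p, T ^ p)`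
(`theta_pow_char`). Hence it contains the universal `p`-envelope, in particular the image of `x`.
Identifying the endomorphism of `H` found in this way with `⁅x, ·⁆` needs the injectivity of `L →
U(L)`, which is the role of the Poincaré–Birkhoff–Witt construction. -/

namespace PBW

/-! ### The Poincaré–Birkhoff–Witt action on polynomials -/

variable {R L I : Type*} [CommRing R] [LieRing L] [LieAlgebra R L]

/-- Polynomials of degree at most `m`, in terms of the basis of monomials. -/
noncomputable def filtration (R : Type*) (I : Type*) [CommRing R] (m : ℕ) :
    Submodule R (Multiset I →₀ R) :=
  Submodule.span R ((fun S => Finsupp.single S 1) '' {S : Multiset I | S.card ≤ m})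

theorem single_mem_filtration {S : Multiset I} {m : ℕ} (h : S.card ≤ m) :
    Finsupp.single S (1 : R) ∈ filtration R I m :=
  Submodule.subset_span ⟨S, h, rfl⟩

theorem filtration_mono {m n : ℕ} (h : m ≤ n) : filtration R I m ≤ filtration R I n :=
  Submodule.span_mono (Set.image_mono fun _ hS => le_trans hS h)

theorem exists_mem_filtration (w : Multiset I →₀ R) : ∃ m, w ∈ filtration R I m := by
  induction w using Finsupp.induction_linear with
  | zero => exact ⟨0, zero_mem _⟩
  | add f g hf hg =>
    obtain ⟨m, hm⟩ := hf
    obtain ⟨n, hn⟩ := hg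
    exact ⟨max m n, add_mem (filtration_mono (le_max_left _ _) hm)
      (filtration_mono (le_max_right _ _) hn)⟩
  | single S c =>
    refine ⟨S.card, ?_⟩
    have : Finsupp.single S c = c • Finsupp.single S (1 : R) := by simp
    rw [this]
    exact Submodule.smul_mem _ _ (single_mem_filtration le_rfl)

/-- The bilinear map with prescribed values on basis elements and monomials. -/
noncomputable def extend (b : Module.Basis I R L) (g : I → Multiset I → (Multiset I →₀ R)) :
    L →ₗ[R] (Multiset I →₀ R) →ₗ[R] (Multiset I →₀ R) :=
  b.constr R fun i => Finsupp.linearCombination R (g i)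

@[simp]
theorem extend_apply (b : Module.Basis I R L) (g : I → Multiset I → (Multiset I →₀ R)) (i : I)
    (S : Multiset I) : extend b g (b i) (Finsupp.single S 1) = g i S := by
  simp [extend, Module.Basis.constr_basis]

/-- A bilinear map agrees with another one on a step of the filtration if it does so on basis
elements and monomials. -/
theorem eq_on_filtration {N : Type*} [AddCommGroup N] [Module R N] (b : Module.Basis I R L)
    {A B : L →ₗ[R] (Multiset I →₀ R) →ₗ[R] N} {m : ℕ}
    (h : ∀ i S, S.card ≤ m →
      A (b i) (Finsupp.single S 1) = B (b i) (Finsupp.single S 1))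
    (x : L) {w : Multiset I →₀ R} (hw : w ∈ filtration R I m) : A x w = B x w := by
  have key : A.flip w = B.flip w := by
    refine b.ext fun i => ?_
    have : filtration R I m ≤ LinearMap.eqLocus (A (b i)) (B (b i)) := by
      rw [filtration, Submodule.span_le]
      rintro _ ⟨S, hS, rfl⟩
      exact h i S hS
    exact this hw
  exact LinearMap.congr_fun key x

theorem map_mem_of_basis {N : Type*} [AddCommGroup N] [Module R N] (b : Module.Basis I R L)
    {A : L →ₗ[R] (Multiset I →₀ R) →ₗ[R] N} {m : ℕ} {V : Submodule R N}
    (h : ∀ i S, S.card ≤ m → A (b i) (Finsupp.single S 1) ∈ V)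
    (x : L) {w : Multiset I →₀ R} (hw : w ∈ filtration R I m) : A x w ∈ V := by
  rw [← Submodule.Quotient.mk_eq_zero, ← Submodule.mkQ_apply]
  exact eq_on_filtration b (A := A.compr₂ V.mkQ) (B := 0)
    (fun i S hS => by simpa using h i S hS) x hw

variable [LinearOrder I]

theorem exists_min {S : Multiset I} {i : I} (h : ¬∀ j ∈ S, i ≤ j) :
    ∃ k ∈ S, k < i ∧ ∀ j ∈ S, k ≤ j := by
  push Not at h
  obtain ⟨j, hj, hji⟩ := h
  have hne : S.toFinset.Nonempty := ⟨j, by simpa using hj⟩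
  refine ⟨S.toFinset.min' hne, by simpa using S.toFinset.min'_mem hne,
    (S.toFinset.min'_le j (by simpa using hj)).trans_lt hji,
    fun l hl => S.toFinset.min'_le l (by simpa using hl)⟩

open Classical in
/-- One step of the recursion that defines the action of `L` on polynomials. -/
noncomputable def step (b : Module.Basis I R L)
    (A : L →ₗ[R] (Multiset I →₀ R) →ₗ[R] (Multiset I →₀ R)) (i : I) (S : Multiset I) :
    Multiset I →₀ R :=
  if h : ∀ j ∈ S, i ≤ j then Finsupp.single (i ::ₘ S) 1
  else
    let k := (exists_min h).choose
    let T := S.erase k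
    -- The value is forced: the monomial `k ::ₘ T` has to be `b k` applied to `T`, and `b i` is
    -- moved past `b k` at the cost of `⁅b i, b k⁆`. The leading term `i ::ₘ T` of `b i` on `T` goes
    -- to `i ::ₘ S` under `b k`, since `k` is minimal; only the remainder needs `A`.
    Finsupp.single (i ::ₘ S) 1
      + A (b k) (A (b i) (Finsupp.single T 1) - Finsupp.single (i ::ₘ T) 1)
      + A ⁅b i, b k⁆ (Finsupp.single T 1)

theorem step_of_le (b : Module.Basis I R L)
    (A : L →ₗ[R] (Multiset I →₀ R) →ₗ[R] (Multiset I →₀ R)) {i : I} {S : Multiset I}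
    (h : ∀ j ∈ S, i ≤ j) : step b A i S = Finsupp.single (i ::ₘ S) 1 := by
  rw [step, dif_pos h]

theorem step_cons (b : Module.Basis I R L)
    (A : L →ₗ[R] (Multiset I →₀ R) →ₗ[R] (Multiset I →₀ R)) {i k : I} {T : Multiset I}
    (hk : ∀ j ∈ T, k ≤ j) (hki : k < i) : step b A i (k ::ₘ T) =
      Finsupp.single (i ::ₘ k ::ₘ T) 1
      + A (b k) (A (b i) (Finsupp.single T 1) - Finsupp.single (i ::ₘ T) 1)
      + A ⁅b i, b k⁆ (Finsupp.single T 1) := by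
  have h : ¬∀ j ∈ k ::ₘ T, i ≤ j := fun h => not_le.2 hki (h k (by simp))
  have hc : (exists_min h).choose = k := by
    obtain ⟨h1, -, h3⟩ := (exists_min h).choose_spec
    refine le_antisymm (h3 k (by simp)) ?_
    rcases Multiset.mem_cons.1 h1 with h1 | h1
    · exact h1.ge
    · exact hk _ h1
  rw [step, dif_neg h]
  simp only [hc, Multiset.erase_cons_head]

/-- Either `i` is at most all elements of `S`, or the least element of `S` is smaller. -/
theorem le_or_exists_cons (i : I) (S : Multiset I) :
    (∀ j ∈ S, i ≤ j) ∨ ∃ k T, S = k ::ₘ T ∧ k < i ∧ ∀ j ∈ T, k ≤ j := by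
  by_cases h : ∀ j ∈ S, i ≤ j
  · exact Or.inl h
  · obtain ⟨k, hk, hki, hkS⟩ := exists_min h
    exact Or.inr ⟨k, S.erase k, (Multiset.cons_erase hk).symm, hki,
      fun j hj => hkS j (Multiset.mem_of_mem_erase hj)⟩

/-- The approximations to the action, correct on polynomials of degree at most `m`. -/
noncomputable def approx (b : Module.Basis I R L) :
    ℕ → L →ₗ[R] (Multiset I →₀ R) →ₗ[R] (Multiset I →₀ R)
  -- The `0` is never consulted in degree zero, where the first branch of `step` applies.
  | 0 => extend b (step b 0)
  | m + 1 => extend b (step b (approx b m))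

theorem approx_single_of_le (b : Module.Basis I R L) (m : ℕ) {i : I} {S : Multiset I}
    (h : ∀ j ∈ S, i ≤ j) :
    approx b m (b i) (Finsupp.single S 1) = Finsupp.single (i ::ₘ S) 1 := by
  cases m <;> simp [approx, step_of_le _ _ h]

/-- Up to lower degree the action is multiplication. This keeps the recursion well founded: the
inner remainder has degree at most that of `T`, one less than that of `k ::ₘ T`. -/
theorem approx_sub_mem (b : Module.Basis I R L) (m : ℕ) (i : I) (S : Multiset I)
    (hS : S.card ≤ m) : approx b m (b i) (Finsupp.single S 1) - Finsupp.single (i ::ₘ S) 1 ∈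
      filtration R I S.card := by
  induction m generalizing i S with
  | zero =>
    rw [approx_single_of_le b 0 (by simp [Multiset.card_eq_zero.1 (Nat.le_zero.1 hS)]), sub_self]
    exact zero_mem _
  | succ m ih =>
    have hmap : ∀ j ≤ m, ∀ x, ∀ w ∈ filtration R I j, approx b m x w ∈ filtration R I (j + 1) := by
      intro j hj x w hw
      refine map_mem_of_basis b (fun i T hT => ?_) x hw
      rw [← sub_add_cancel (approx b m (b i) (Finsupp.single T 1)) (Finsupp.single (i ::ₘ T) 1)]
      exact add_mem (filtration_mono (by omega) (ih i T (hT.trans hj)))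
        (single_mem_filtration (by simpa using hT))
    rcases le_or_exists_cons i S with h | ⟨k, T, rfl, hki, hk⟩
    · rw [approx_single_of_le b _ h, sub_self]
      exact zero_mem _
    · rw [Multiset.card_cons] at hS ⊢
      rw [approx, extend_apply, step_cons b _ hk hki, add_assoc, add_sub_cancel_left]
      exact add_mem (hmap _ (by omega) _ _ (ih i T (by omega)))
        (hmap _ (by omega) _ _ (single_mem_filtration le_rfl))

/-- In degree at most `m + 1` the recursion evaluates the previous approximation only in degree at
most `m`, where two consecutive approximations agree by induction. -/
theorem approx_succ (b : Module.Basis I R L) (m : ℕ) (x : L) {w : Multiset I →₀ R}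
    (hw : w ∈ filtration R I m) : approx b (m + 1) x w = approx b m x w := by
  induction m generalizing x w with
  | zero =>
    refine eq_on_filtration b (fun i S hS => ?_) x hw
    have : ∀ j ∈ S, i ≤ j := by simp [Multiset.card_eq_zero.1 (Nat.le_zero.1 hS)]
    rw [approx_single_of_le b _ this, approx_single_of_le b _ this]
  | succ m ih =>
    refine eq_on_filtration b (fun i S hS => ?_) x hw
    rcases le_or_exists_cons i S with h | ⟨k, T, rfl, hki, hk⟩
    · rw [approx_single_of_le b _ h, approx_single_of_le b _ h]
    · rw [Multiset.card_cons] at hS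
      have hT : Finsupp.single T (1 : R) ∈ filtration R I m := single_mem_filtration (by omega)
      rw [approx, extend_apply, step_cons b _ hk hki]
      conv_rhs => rw [approx, extend_apply, step_cons b _ hk hki]
      rw [ih _ hT, ih _ hT, ih _ (filtration_mono (by omega) (approx_sub_mem b m i T (by omega)))]

theorem approx_of_le (b : Module.Basis I R L) {m n : ℕ} (h : m ≤ n) (x : L) {w : Multiset I →₀ R}
    (hw : w ∈ filtration R I m) : approx b n x w = approx b m x w := by
  induction n, h using Nat.le_induction with
  | base => rfl
  | succ n hn ih => rw [approx_succ b n x (filtration_mono hn hw), ih]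

/-- The action of `L` on polynomials. -/
noncomputable def act (b : Module.Basis I R L) :
    L →ₗ[R] (Multiset I →₀ R) →ₗ[R] (Multiset I →₀ R) :=
  extend b fun i S => approx b S.card (b i) (Finsupp.single S 1)

theorem act_eq_approx (b : Module.Basis I R L) {m : ℕ} (x : L) {w : Multiset I →₀ R}
    (hw : w ∈ filtration R I m) : act b x w = approx b m x w := by
  refine eq_on_filtration b (fun i S hS => ?_) x hw
  rw [act, extend_apply, approx_of_le b hS _ (single_mem_filtration le_rfl)]

theorem act_single_of_le (b : Module.Basis I R L) {i : I} {S : Multiset I}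
    (h : ∀ j ∈ S, i ≤ j) :
    act b (b i) (Finsupp.single S 1) = Finsupp.single (i ::ₘ S) 1 := by
  rw [act, extend_apply, approx_single_of_le b _ h]

theorem act_sub_mem (b : Module.Basis I R L) (i : I) (S : Multiset I) :
    act b (b i) (Finsupp.single S 1) - Finsupp.single (i ::ₘ S) 1 ∈ filtration R I S.card := by
  rw [act, extend_apply]
  exact approx_sub_mem b _ i S le_rfl

theorem act_single_cons (b : Module.Basis I R L) {i k : I} {T : Multiset I}
    (hk : ∀ j ∈ T, k ≤ j) (hki : k < i) : act b (b i) (Finsupp.single (k ::ₘ T) 1) =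
      Finsupp.single (i ::ₘ k ::ₘ T) 1
      + act b (b k) (act b (b i) (Finsupp.single T 1) - Finsupp.single (i ::ₘ T) 1)
      + act b ⁅b i, b k⁆ (Finsupp.single T 1) := by
  rw [act, extend_apply, Multiset.card_cons, approx, extend_apply, step_cons b _ hk hki, ← act,
    act_eq_approx b _ (act_sub_mem b i T),
    act_eq_approx b (m := T.card) _ (single_mem_filtration le_rfl),
    act_eq_approx b (m := T.card) _ (single_mem_filtration le_rfl)]

/-- This is the defining recursion read backwards, in the case where `k` may be placed in front of
`T`. -/
theorem act_comm_of_lt (b : Module.Basis I R L) {i k : I} {T : Multiset I}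
    (hk : ∀ j ∈ T, k ≤ j) (hki : k < i) :
    act b (b i) (act b (b k) (Finsupp.single T 1)) =
      act b (b k) (act b (b i) (Finsupp.single T 1)) + act b ⁅b i, b k⁆ (Finsupp.single T 1) := by
  have hle : ∀ j ∈ i ::ₘ T, k ≤ j := by
    intro j hj
    rcases Multiset.mem_cons.1 hj with rfl | hj
    · exact hki.le
    · exact hk j hj
  rw [act_single_of_le b hk, act_single_cons b hk hki, map_sub, act_single_of_le b hle,
    Multiset.cons_swap i k T]
  abel

/-- Induction on the degree. By bilinearity and antisymmetry it suffices to treat `b i`, `b k` with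
`k < i` on a monomial `T`. If `k` is not minimal, then `T` is `b n` applied to a smaller monomial
`S` with `n < k < i`; moving `b n` to the front on both sides leaves the Jacobi identity. -/
theorem act_comm (b : Module.Basis I R L) (m : ℕ) : ∀ (x y : L), ∀ w ∈ filtration R I m,
    act b x (act b y w) = act b y (act b x w) + act b ⁅x, y⁆ w := by
  induction m using Nat.strong_induction_on with
  | _ m ih =>
  suffices H : ∀ i k (T : Multiset I), T.card ≤ m →
      act b (b i) (act b (b k) (Finsupp.single T 1)) =
      act b (b k) (act b (b i) (Finsupp.single T 1)) +
        act b ⁅b i, b k⁆ (Finsupp.single T 1) by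
    intro x y w hw
    have h1 : ∀ k, act b x (act b (b k) w) = act b (b k) (act b x w) + act b ⁅x, b k⁆ w := by
      intro k
      refine eq_on_filtration b (A := (act b).compl₂ (act b (b k)))
        (B := (act b).compr₂ (act b (b k)) +
          (act b).comp (-LieAlgebra.ad R L (b k) : L →ₗ[R] L))
        (fun i T hT => ?_) x hw |>.trans ?_
      · simpa using H i k T hT
      · simp
    have h2 : (act b x).comp ((act b).flip w) =
        (act b).flip (act b x w) + ((act b).flip w).comp (LieAlgebra.ad R L x : L →ₗ[R] L) := by
      refine b.ext fun k => ?_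
      simpa using h1 k
    simpa using LinearMap.congr_fun h2 y
  suffices H : ∀ i k (T : Multiset I), T.card ≤ m → k < i →
      act b (b i) (act b (b k) (Finsupp.single T 1)) =
      act b (b k) (act b (b i) (Finsupp.single T 1)) +
        act b ⁅b i, b k⁆ (Finsupp.single T 1) by
    intro i k T hT
    rcases lt_trichotomy k i with hki | rfl | hik
    · exact H i k T hT hki
    · simp
    · rw [H k i T hT hik, ← lie_skew, map_neg, LinearMap.neg_apply]
      abel
  intro i k T hT hki
  rcases le_or_exists_cons k T with hk | ⟨n, S, rfl, hnk, hn⟩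
  · exact act_comm_of_lt b hk hki
  rw [Multiset.card_cons] at hT
  have hS : Finsupp.single S (1 : R) ∈ filtration R I S.card := single_mem_filtration le_rfl
  -- `b k` applied to `S` has degree one too large for the induction hypothesis. Its leading
  -- monomial `k ::ₘ S` is covered by `act_comm_of_lt`, as `n` is minimal, and the remainder by
  -- induction.
  have comm : ∀ i k : I, n < i → n < k →
      act b (b i) (act b (b n) (act b (b k) (Finsupp.single S 1))) =
        act b (b n) (act b (b i) (act b (b k) (Finsupp.single S 1))) +
          act b ⁅b i, b n⁆ (act b (b k) (Finsupp.single S 1)) := by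
    intro i k hni hnk
    have hle : ∀ j ∈ k ::ₘ S, n ≤ j := by
      intro j hj
      rcases Multiset.mem_cons.1 hj with rfl | hj
      · exact hnk.le
      · exact hn j hj
    have h1 := act_comm_of_lt b hle hni
    have h2 := ih S.card (by omega) (b i) (b n) _ (act_sub_mem b k S)
    simp only [map_sub] at h2
    rw [h1, sub_eq_iff_eq_add] at h2
    rw [h2]
    abel
  have hik := comm i k (hnk.trans hki) hnk
  have hki' := comm k i hnk (hnk.trans hki)
  have hS' := ih S.card (by omega)
  have jac : act b ⁅b i, ⁅b k, b n⁆⁆ (Finsupp.single S 1) =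
      act b ⁅⁅b i, b k⁆, b n⁆ (Finsupp.single S 1) +
        act b ⁅b k, ⁅b i, b n⁆⁆ (Finsupp.single S 1) := by
    rw [leibniz_lie, map_add, LinearMap.add_apply]
  rw [← act_single_of_le b hn, hS' (b k) (b n) _ hS, hS' (b i) (b n) _ hS, map_add, map_add, hik,
    hki', hS' _ (b n) _ hS, hS' (b i) ⁅b k, b n⁆ _ hS, hS' (b k) ⁅b i, b n⁆ _ hS,
    hS' (b i) (b k) _ hS, map_add, jac]
  abel

/-- The representation of `L` on polynomials. -/
noncomputable def rep (b : Module.Basis I R L) :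
    L →ₗ⁅R⁆ Module.End R (Multiset I →₀ R) :=
  { act b with
    map_lie' := fun {x y} => by
      refine LinearMap.ext fun w => ?_
      obtain ⟨m, hm⟩ := exists_mem_filtration w
      have h := act_comm b m x y w hm
      change act b ⁅x, y⁆ w = act b x (act b y w) - act b y (act b x w)
      rw [h, add_sub_cancel_left] }

end PBW

/-- A Lie algebra that is free as a module embeds into its universal enveloping algebra. -/
theorem UniversalEnvelopingAlgebra.ι_injective {R L : Type*} [CommRing R] [LieRing L]
    [LieAlgebra R L] [Module.Free R L] :
    Function.Injective (UniversalEnvelopingAlgebra.ι R (L := L)) := by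
  let b := Module.Free.chooseBasis R L
  classical
  let := linearOrderOfSTO (WellOrderingRel (α := Module.Free.ChooseBasisIndex R L))
  -- Applied to the constant polynomial `1`, an element of `L` gives the linear polynomial of its
  -- coordinates, so the representation separates elements of `L`.
  have hact : ∀ x, PBW.act b x (Finsupp.single 0 1) =
      Finsupp.mapDomain (fun i => {i}) (b.repr x) := by
    intro x
    have : (PBW.act b).flip (Finsupp.single 0 1) =
        (Finsupp.lmapDomain R R fun i => ({i} : Multiset _)).comp b.repr.toLinearMap := by
      refine b.ext fun i => ?_
      rw [LinearMap.flip_apply, PBW.act_single_of_le b (by simp)]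
      simp
    exact LinearMap.congr_fun this x
  intro x y hxy
  have h := congrArg (UniversalEnvelopingAlgebra.lift R (PBW.rep b)) hxy
  rw [UniversalEnvelopingAlgebra.lift_ι_apply, UniversalEnvelopingAlgebra.lift_ι_apply] at h
  have h' : PBW.act b x (Finsupp.single 0 1) = PBW.act b y (Finsupp.single 0 1) :=
    LinearMap.congr_fun h _
  rw [hact, hact] at h'
  exact b.repr.injective (Finsupp.mapDomain_injective (fun _ _ => Multiset.singleton_inj.1) h')

/-! ### Operators on cochains and their `p`-th powers -/

theorem sub_pow_of_commute_of_charP {F R : Type*} [Field F] [Ring R] [Algebra F R] (p : ℕ)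
    [Fact p.Prime] [CharP F p] {a b : R} (h : Commute a b) : (a - b) ^ p = a ^ p - b ^ p := by
  rcases subsingleton_or_nontrivial R with hR | hR
  · exact Subsingleton.elim _ _
  · have : CharP R p := charP_of_injective_algebraMap (algebraMap F R).injective p
    exact sub_pow_char_of_commute p h

namespace ChevalleyEilenberg

section Cochains

variable {F L M : Type*} [Field F] [AddCommGroup L] [Module F L] [AddCommGroup M] [Module F M]

theorem ext_curryLeft {n : ℕ} {f g : L [⋀^Fin (n + 1)]→ₗ[F] M}
    (h : ∀ x, f.curryLeft x = g.curryLeft x) : f = g := by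
  ext v
  rw [← Fin.cons_self_tail v]
  exact AlternatingMap.congr_fun (h (v 0)) (Fin.tail v)

/-- Polarization of the vanishing of the double contraction with `x + y`. -/
theorem curryLeft_curryLeft_eq_neg {n : ℕ} (f : L [⋀^Fin (n + 2)]→ₗ[F] M) (x y : L) :
    (f.curryLeft x).curryLeft y = -(f.curryLeft y).curryLeft x := by
  have h := AlternatingMap.curryLeft_same f (x + y)
  simp only [map_add, LinearMap.add_apply, AlternatingMap.curryLeft_add,
    AlternatingMap.curryLeft_same, zero_add, add_zero] at h
  rw [add_comm] at h
  exact eq_neg_of_add_eq_zero_left (by simpa using h)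

/-- The multilinear map `v ↦ T (f v) - ∑ₖ f (…, D vₖ, …)`. -/
def thetaAux (D : Module.End F L) (T : Module.End F M) {n : ℕ} (f : L [⋀^Fin n]→ₗ[F] M) :
    MultilinearMap F (fun _ : Fin n => L) M :=
  T.compMultilinearMap f.toMultilinearMap -
    ∑ k : Fin n, f.toMultilinearMap.compLinearMap (fun j => if j = k then D else LinearMap.id)

theorem thetaAux_apply (D : Module.End F L) (T : Module.End F M) {n : ℕ}
    (f : L [⋀^Fin n]→ₗ[F] M) (v : Fin n → L) :
    thetaAux D T f v = T (f v) - ∑ k : Fin n, f (Function.update v k (D (v k))) := by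
  simp only [thetaAux, sub_apply, sum_apply]
  congr 1
  refine Finset.sum_congr rfl fun k _ => ?_
  rw [MultilinearMap.compLinearMap_apply]
  refine congrArg f (funext fun j => ?_)
  by_cases h : j = k
  · subst h; simp
  · simp [h]

/-- The action of `(D, T) ∈ 𝔤𝔩(L) × 𝔤𝔩(M)` on cochains. -/
def theta (D : Module.End F L) (T : Module.End F M) (n : ℕ) :
    Module.End F (L [⋀^Fin n]→ₗ[F] M) where
  toFun f :=
    { thetaAux D T f with
      map_eq_zero_of_eq' := by
        intro v a b hv hab
        change thetaAux D T f v = 0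
        rw [thetaAux_apply, f.map_eq_zero_of_eq v hv hab, map_zero, zero_sub, neg_eq_zero,
          Fintype.sum_eq_add a b hab]
        · have h := f.map_swap (Function.update v b (D (v b))) hab
          rw [add_eq_zero_iff_eq_neg, ← h]
          refine congrArg f (funext fun j => ?_)
          by_cases ha : j = a
          · subst ha; simp [hv]
          · by_cases hb : j = b
            · subst hb; simp [hv, hab, hab.symm]
            · simp [Equiv.swap_apply_of_ne_of_ne ha hb, ha, hb]
        · rintro k ⟨hka, hkb⟩
          exact f.map_eq_zero_of_eq _ (by simp [hka.symm, hkb.symm, hv]) hab }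
  map_add' f g := by
    ext v
    change thetaAux D T (f + g) v = thetaAux D T f v + thetaAux D T g v
    simp only [thetaAux_apply, AlternatingMap.add_apply, map_add, Finset.sum_add_distrib]
    abel
  map_smul' c f := by
    ext v
    change thetaAux D T (c • f) v = c • thetaAux D T f v
    simp only [thetaAux_apply, AlternatingMap.smul_apply, map_smul, ← Finset.smul_sum, smul_sub]

theorem theta_apply (D : Module.End F L) (T : Module.End F M) {n : ℕ}
    (f : L [⋀^Fin n]→ₗ[F] M) (v : Fin n → L) :
    theta D T n f v = T (f v) - ∑ k : Fin n, f (Function.update v k (D (v k))) :=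
  thetaAux_apply D T f v

/-- The commutation rule of `theta` with contractions; with `ext_curryLeft` it reduces operator
identities to one degree lower. -/
theorem curryLeft_theta (D : Module.End F L) (T : Module.End F M) {n : ℕ}
    (f : L [⋀^Fin (n + 1)]→ₗ[F] M) (y : L) :
    (theta D T (n + 1) f).curryLeft y = theta D T n (f.curryLeft y) - f.curryLeft (D y) := by
  ext v
  simp only [AlternatingMap.curryLeft_apply_apply, AlternatingMap.sub_apply, theta_apply,
    Matrix.vecCons, Fin.sum_univ_succ, Fin.cons_zero, Fin.cons_succ, ← Fin.cons_update,
    Fin.update_cons_zero]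
  abel

theorem theta_add (D D' : Module.End F L) (T T' : Module.End F M) (n : ℕ) :
    theta (D + D') (T + T') n = theta D T n + theta D' T' n := by
  ext f v
  simp only [LinearMap.add_apply, AlternatingMap.add_apply, theta_apply,
    AlternatingMap.map_update_add, Finset.sum_add_distrib]
  abel

theorem theta_smul (c : F) (D : Module.End F L) (T : Module.End F M) (n : ℕ) :
    theta (c • D) (c • T) n = c • theta D T n := by
  ext f v
  simp only [LinearMap.smul_apply, AlternatingMap.smul_apply, theta_apply,
    AlternatingMap.map_update_smul, ← Finset.smul_sum, smul_sub]

theorem theta_zero (n : ℕ) : theta (0 : Module.End F L) (0 : Module.End F M) n = 0 := by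
  simpa using theta_smul (0 : F) (0 : Module.End F L) (0 : Module.End F M) n

theorem theta_commutator (D D' : Module.End F L) (T T' : Module.End F M) :
    ∀ (n : ℕ) (f : L [⋀^Fin n]→ₗ[F] M),
    theta D T n (theta D' T' n f) - theta D' T' n (theta D T n f) =
      theta (D * D' - D' * D) (T * T' - T' * T) n f
  | 0, f => by ext v; simp [theta_apply]
  | n + 1, f => by
    refine ext_curryLeft fun y => ?_
    rw [← AlternatingMap.curryLeftLinearMap_apply, map_sub, LinearMap.sub_apply]
    simp only [AlternatingMap.curryLeftLinearMap_apply, curryLeft_theta, map_sub, LinearMap.sub_apply,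
      Module.End.mul_apply, ← theta_commutator D D' T T' n]
    abel

/-- Viewing an `(n + 1)`-cochain as a linear map from `L` to `n`-cochains turns `theta` into `A -
B`, where `A` composes with `theta` in degree `n` and `B` precomposes with `D`. These commute, so
`(A - B) ^ p = A ^ p - B ^ p`, and induction applies to `A ^ p`. -/
theorem theta_pow_char (p : ℕ) [Fact p.Prime] [CharP F p] (D : Module.End F L)
    (T : Module.End F M) (n : ℕ) : theta D T n ^ p = theta (D ^ p) (T ^ p) n := by
  induction n with
  | zero =>
    have h : ∀ k, theta D T 0 ^ k = theta (D ^ k) (T ^ k) 0 := by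
      intro k
      induction k with
      | zero => ext f v; simp [theta_apply]
      | succ k ih => ext f v; simp [pow_succ', ih, theta_apply]
    exact h p
  | succ n ih =>
    let A : Module.End F (L →ₗ[F] L [⋀^Fin n]→ₗ[F] M) := LinearMap.compRight F (theta D T n)
    let B : Module.End F (L →ₗ[F] L [⋀^Fin n]→ₗ[F] M) := LinearMap.lcomp F _ D
    have hA : ∀ k g y, (A ^ k) g y = (theta D T n ^ k) (g y) := by
      intro k
      induction k with
      | zero => simp
      | succ k ihk => intro g y; simp [pow_succ, ihk, A]
    have hB : ∀ k g y, (B ^ k) g y = g ((D ^ k) y) := by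
      intro k
      induction k with
      | zero => simp
      | succ k ihk => intro g y; rw [pow_succ, Module.End.mul_apply, ihk, pow_succ']; simp [B]
    have hAB : Commute A B := by
      ext g
      simp [A, B]
    have hpow : (A - B) ^ p = A ^ p - B ^ p :=
      sub_pow_of_commute_of_charP (F := F)
        (R := Module.End F (L →ₗ[F] L [⋀^Fin n]→ₗ[F] M)) p hAB
    have hc : ∀ k (f : L [⋀^Fin (n + 1)]→ₗ[F] M),
        ((theta D T (n + 1) ^ k) f).curryLeft = ((A - B) ^ k) f.curryLeft := by
      intro k
      induction k with
      | zero => simp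
      | succ k ihk =>
        intro f
        rw [pow_succ, pow_succ, Module.End.mul_apply, Module.End.mul_apply, ihk]
        congr 1
        ext1 y
        rw [curryLeft_theta]
        simp [A, B]
    ext1 f
    refine ext_curryLeft fun y => ?_
    rw [hc, hpow, LinearMap.sub_apply, LinearMap.sub_apply, hA, hB, ih, curryLeft_theta]

end Cochains

/-! ### Cartan calculus and trivial action on cohomology -/

section Differential

variable {F L M : Type*} [Field F] [LieRing L] [LieAlgebra F L] [AddCommGroup M] [Module F M]
  (ρ : L →ₗ⁅F⁆ Module.End F M)

/-- The Lie derivative on cochains. -/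
def lieTheta (x : L) (n : ℕ) : Module.End F (L [⋀^Fin n]→ₗ[F] M) :=
  theta (LieAlgebra.ad F L x) (ρ x) n

theorem curryLeft_d_zero (f : L [⋀^Fin 0]→ₗ[F] M) (x : L) :
    (d ρ 0 f).curryLeft x = lieTheta ρ x 0 f := by
  ext v
  rw [lieTheta, theta_apply]
  change coboundaryFormula ρ f _ = _
  simp [coboundaryFormula, Subsingleton.elim _ v]

/-- Cartan's formula. It determines `d` recursively, so the properties of `d` below follow by
induction without the explicit sum. -/
theorem curryLeft_d_succ {n : ℕ} (f : L [⋀^Fin (n + 1)]→ₗ[F] M) (x : L) :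
    (d ρ (n + 1) f).curryLeft x = lieTheta ρ x (n + 1) f - d ρ n (f.curryLeft x) := by
  ext v
  rw [AlternatingMap.sub_apply, lieTheta, theta_apply]
  have h := coboundaryFormula_cons ρ f x v
  rw [lieDeriv_apply] at h
  exact h

/-- A pair of a derivation of `L` and a compatible endomorphism of `M`. -/
structure IsCompatible (D : Module.End F L) (T : Module.End F M) : Prop where
  map_lie : ∀ x y, D ⁅x, y⁆ = ⁅D x, y⁆ + ⁅x, D y⁆
  commutator : ∀ x, T * ρ x - ρ x * T = ρ (D x)

variable {ρ}

theorem isCompatible_ad (x : L) : IsCompatible ρ (LieAlgebra.ad F L x) (ρ x) where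
  map_lie y z := by simp
  commutator y := by
    rw [LieAlgebra.ad_apply, LieHom.map_lie, LieRing.of_associative_ring_bracket]

theorem IsCompatible.theta_lieTheta {D : Module.End F L} {T : Module.End F M}
    (h : IsCompatible ρ D T) (x : L) {n : ℕ} (f : L [⋀^Fin n]→ₗ[F] M) :
    theta D T n (lieTheta ρ x n f) = lieTheta ρ x n (theta D T n f) + lieTheta ρ (D x) n f := by
  have hD : D * LieAlgebra.ad F L x - LieAlgebra.ad F L x * D = LieAlgebra.ad F L (D x) := by
    ext y
    simp [h.map_lie]
  rw [← sub_eq_iff_eq_add']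
  simp only [lieTheta]
  rw [theta_commutator, hD, h.commutator]

/-- After contraction with `x`, Cartan's formula leaves the commutator of `theta D T` with the Lie
derivative of `x`, which is the Lie derivative of `D x`; this cancels the correction term of
`curryLeft_theta`. -/
theorem IsCompatible.theta_d {D : Module.End F L} {T : Module.End F M}
    (h : IsCompatible ρ D T) : ∀ (n : ℕ) (f : L [⋀^Fin n]→ₗ[F] M),
    theta D T (n + 1) (d ρ n f) = d ρ n (theta D T n f)
  | 0, f => by
    refine ext_curryLeft fun x => ?_
    rw [curryLeft_theta, curryLeft_d_zero, curryLeft_d_zero, curryLeft_d_zero, h.theta_lieTheta,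
      add_sub_cancel_right]
  | n + 1, f => by
    refine ext_curryLeft fun x => ?_
    rw [curryLeft_theta, curryLeft_d_succ, curryLeft_d_succ, curryLeft_d_succ, map_sub,
      h.theta_lieTheta, h.theta_d n, curryLeft_theta, map_sub]
    abel

/-- Contracting `d d f` with `x` gives `θₓ d f - d (θₓ f - d (ιₓ f))`; the Lie derivative `θₓ`
commutes with `d`, and `d d (ιₓ f) = 0` by induction. -/
theorem d_d : ∀ (n : ℕ) (f : L [⋀^Fin n]→ₗ[F] M), d ρ (n + 1) (d ρ n f) = 0
  | 0, f => by
    refine ext_curryLeft fun x => ?_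
    rw [curryLeft_d_succ, curryLeft_d_zero, lieTheta, (isCompatible_ad x).theta_d, lieTheta,
      sub_self, AlternatingMap.curryLeft_zero, LinearMap.zero_apply]
  | n + 1, f => by
    refine ext_curryLeft fun x => ?_
    rw [curryLeft_d_succ, curryLeft_d_succ, lieTheta, (isCompatible_ad x).theta_d, lieTheta,
      map_sub, d_d n, sub_zero, sub_self, AlternatingMap.curryLeft_zero, LinearMap.zero_apply]

variable (ρ)

theorem coboundaries_le_cocycles : ∀ n, coboundaries ρ n ≤ cocycles ρ n
  | 0 => bot_le
  | n + 1 => by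
    rintro _ ⟨f, rfl⟩
    exact d_d n f

/-- The pair `(D, T)` maps cocycles to coboundaries, that is, it acts as zero on cohomology. -/
def ActsTrivially (D : Module.End F L) (T : Module.End F M) : Prop :=
  ∀ n, ∀ f ∈ cocycles ρ n, theta D T n f ∈ coboundaries ρ n

/-- For a cocycle `f`, Cartan's formula says that the Lie derivative is `d` of the contraction of
`f`. In degree zero it is zero. -/
theorem actsTrivially_ad (x : L) : ActsTrivially ρ (LieAlgebra.ad F L x) (ρ x) := by
  intro n f hf
  have hf' : d ρ n f = 0 := hf
  cases n with
  | zero =>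
    have h := curryLeft_d_zero ρ f x
    rw [hf', AlternatingMap.curryLeft_zero, LinearMap.zero_apply] at h
    exact h.symm
  | succ n =>
    have h := curryLeft_d_succ ρ f x
    rw [hf', AlternatingMap.curryLeft_zero, LinearMap.zero_apply] at h
    exact ⟨f.curryLeft x, (sub_eq_zero.1 h.symm).symm⟩

variable {ρ}

theorem ActsTrivially.add {D D' : Module.End F L} {T T' : Module.End F M}
    (h : ActsTrivially ρ D T) (h' : ActsTrivially ρ D' T') : ActsTrivially ρ (D + D') (T + T') := by
  intro n f hf
  rw [theta_add]
  exact add_mem (h n f hf) (h' n f hf)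

theorem ActsTrivially.smul (c : F) {D : Module.End F L} {T : Module.End F M}
    (h : ActsTrivially ρ D T) : ActsTrivially ρ (c • D) (c • T) := by
  intro n f hf
  rw [theta_smul]
  exact Submodule.smul_mem _ _ (h n f hf)

theorem actsTrivially_zero : ActsTrivially ρ 0 0 := by
  intro n f hf
  rw [theta_zero]
  exact zero_mem _

theorem ActsTrivially.commutator {D D' : Module.End F L} {T T' : Module.End F M}
    (h : ActsTrivially ρ D T) (h' : ActsTrivially ρ D' T') :
    ActsTrivially ρ (D * D' - D' * D) (T * T' - T' * T) := by
  intro n f hf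
  rw [← theta_commutator]
  exact sub_mem (h n _ (coboundaries_le_cocycles ρ n (h' n f hf)))
    (h' n _ (coboundaries_le_cocycles ρ n (h n f hf)))

theorem ActsTrivially.pow_char (p : ℕ) [Fact p.Prime] [CharP F p] {D : Module.End F L}
    {T : Module.End F M} (h : ActsTrivially ρ D T) : ActsTrivially ρ (D ^ p) (T ^ p) := by
  intro n f hf
  rw [← theta_pow_char]
  have key : ∀ k, (theta D T n ^ (k + 1)) f ∈ coboundaries ρ n := by
    intro k
    induction k with
    | zero => simpa using h n f hf
    | succ k ih =>
      rw [pow_succ', Module.End.mul_apply]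
      exact h n _ (coboundaries_le_cocycles ρ n ih)
  obtain ⟨k, hk⟩ := Nat.exists_eq_succ_of_ne_zero (Fact.out : p.Prime).ne_zero
  rw [hk]
  exact key k

end Differential

end ChevalleyEilenberg

/-! ### Cochains on a codimension-one extension -/

namespace ChevalleyEilenberg

section Restriction

variable {F L G M : Type*} [Field F] [AddCommGroup L] [Module F L] [AddCommGroup G] [Module F G]
  [AddCommGroup M] [Module F M]

/-- Restriction of cochains along a linear map. -/
def restrict (j : L →ₗ[F] G) (n : ℕ) : G [⋀^Fin n]→ₗ[F] M →ₗ[F] L [⋀^Fin n]→ₗ[F] M where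
  toFun f := f.compLinearMap j
  map_add' _ _ := rfl
  map_smul' _ _ := rfl

theorem restrict_apply (j : L →ₗ[F] G) {n : ℕ} (f : G [⋀^Fin n]→ₗ[F] M) (v : Fin n → L) :
    restrict j n f v = f (j ∘ v) := rfl

theorem curryLeft_restrict (j : L →ₗ[F] G) {n : ℕ} (f : G [⋀^Fin (n + 1)]→ₗ[F] M) (x : L) :
    (restrict j (n + 1) f).curryLeft x = restrict j n (f.curryLeft (j x)) :=
  AlternatingMap.curryLeft_compLinearMap j f x

theorem restrict_theta {j : L →ₗ[F] G} {D : Module.End F L} {D' : Module.End F G}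
    (h : ∀ x, j (D x) = D' (j x)) (T : Module.End F M) {n : ℕ} (f : G [⋀^Fin n]→ₗ[F] M) :
    restrict j n (theta D' T n f) = theta D T n (restrict j n f) := by
  ext v
  simp only [restrict_apply, theta_apply, Function.comp_update, h, Function.comp_apply]

/-- Cochains on the direct sum of `L` and a line spanned by `x` are pairs of cochains on `L`. -/
theorem eq_zero_of_restrict_eq_zero {j : L →ₗ[F] G} {x : G}
    (hx : ∀ y, ∃ (a : L) (c : F), y = j a + c • x) : ∀ {n : ℕ} {f : G [⋀^Fin (n + 1)]→ₗ[F] M},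
    restrict j (n + 1) f = 0 → restrict j n (f.curryLeft x) = 0 → f = 0 := by
  intro n
  induction n with
  | zero =>
    intro f h0 h1
    refine ext_curryLeft fun y => ?_
    obtain ⟨a, c, rfl⟩ := hx y
    have hinj : ∀ g : G [⋀^Fin 0]→ₗ[F] M, restrict j 0 g = 0 → g = 0 := by
      intro g hg
      ext v
      rw [Subsingleton.elim v (j ∘ Fin.elim0)]
      exact AlternatingMap.congr_fun hg Fin.elim0
    rw [map_add, map_smul, hinj _ h1, hinj (f.curryLeft (j a)) (by
      rw [← curryLeft_restrict, h0, AlternatingMap.curryLeft_zero, LinearMap.zero_apply]),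
      AlternatingMap.curryLeft_zero, LinearMap.zero_apply, smul_zero, add_zero]
  | succ n ih =>
    intro f h0 h1
    refine ext_curryLeft fun y => ?_
    obtain ⟨a, c, rfl⟩ := hx y
    -- The second condition of the induction hypothesis is free here: contracting twice with `x`
    -- gives zero.
    have hx0 : f.curryLeft x = 0 := ih h1 (by rw [AlternatingMap.curryLeft_same, map_zero])
    have ha : f.curryLeft (j a) = 0 := by
      refine ih ?_ ?_
      · rw [← curryLeft_restrict, h0, AlternatingMap.curryLeft_zero, LinearMap.zero_apply]
      · rw [curryLeft_curryLeft_eq_neg, hx0, AlternatingMap.curryLeft_zero, LinearMap.zero_apply,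
          neg_zero, map_zero]
    rw [map_add, map_smul, hx0, ha, AlternatingMap.curryLeft_zero, LinearMap.zero_apply, smul_zero,
      add_zero]

/-- The cochain is `π^* a + ξ ∧ π^* b`: the second summand vanishes on `L` and contracts with `x` to
`π^* b`, while `π^* a` is killed by that contraction since `π x = 0`. -/
theorem exists_restrict_eq {j : L →ₗ[F] G} {x : G} {π : G →ₗ[F] L} {ξ : G →ₗ[F] F}
    (hπj : ∀ y, π (j y) = y) (hξj : ∀ y, ξ (j y) = 0) (hπx : π x = 0) (hξx : ξ x = 1)
    {n : ℕ} (a : L [⋀^Fin (n + 1)]→ₗ[F] M) (b : L [⋀^Fin n]→ₗ[F] M) :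
    ∃ f : G [⋀^Fin (n + 1)]→ₗ[F] M, restrict j (n + 1) f = a ∧
      restrict j n (f.curryLeft x) = b := by
  have hπj' : ∀ {m : ℕ} (v : Fin m → L), π ∘ j ∘ v = v := fun v => funext fun i => hπj _
  refine ⟨restrict π (n + 1) a +
    AlternatingMap.alternatizeUncurryFin (ξ.smulRight (restrict π n b)), ?_, ?_⟩
  · ext v
    simp [restrict_apply, AlternatingMap.alternatizeUncurryFin_apply, hπj', hξj]
  · ext v
    rw [restrict_apply, AlternatingMap.curryLeft_apply_apply, AlternatingMap.add_apply,
      AlternatingMap.alternatizeUncurryFin_apply, restrict_apply,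
      a.map_coord_zero (0 : Fin (n + 1)) (by simpa using hπx), zero_add, Fin.sum_univ_succ]
    simp [restrict_apply, hπj', hξj, hξx, Matrix.vecCons]

variable (j : L →ₗ[F] G) (x : G)

/-- The isomorphism between cochains on `L ⊕ F x` and pairs of cochains on `L`. -/
noncomputable def splitEquiv (π : G →ₗ[F] L) (ξ : G →ₗ[F] F)
    (hπj : ∀ y, π (j y) = y) (hξj : ∀ y, ξ (j y) = 0) (hπx : π x = 0) (hξx : ξ x = 1)
    (hx : ∀ y, ∃ (a : L) (c : F), y = j a + c • x) (n : ℕ) :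
    (G [⋀^Fin (n + 1)]→ₗ[F] M) ≃ₗ[F] (L [⋀^Fin (n + 1)]→ₗ[F] M) × (L [⋀^Fin n]→ₗ[F] M) :=
  LinearEquiv.ofBijective
    ((restrict j (n + 1)).prod
      ((restrict j n).comp ((LinearMap.applyₗ x).comp AlternatingMap.curryLeftLinearMap)))
    ⟨by
      rw [← LinearMap.ker_eq_bot, LinearMap.ker_eq_bot']
      intro f hf
      exact eq_zero_of_restrict_eq_zero hx (congrArg Prod.fst hf) (congrArg Prod.snd hf),
    by
      rintro ⟨a, b⟩
      obtain ⟨f, h1, h2⟩ := exists_restrict_eq hπj hξj hπx hξx a b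
      exact ⟨f, Prod.ext h1 h2⟩⟩

instance finite_alternatingMap [FiniteDimensional F L] [FiniteDimensional F M] (n : ℕ) :
    FiniteDimensional F (L [⋀^Fin n]→ₗ[F] M) :=
  Module.Finite.of_injective
    ({ toFun := fun f => f.toMultilinearMap
       map_add' := fun _ _ => rfl
       map_smul' := fun _ _ => rfl } :
      L [⋀^Fin n]→ₗ[F] M →ₗ[F] MultilinearMap F (fun _ : Fin n => L) M)
    AlternatingMap.coe_multilinearMap_injective

end Restriction

/-! ### Betti numbers and their behaviour in one step -/

section Dimension

variable {F L G M : Type*} [Field F] [LieRing L] [LieAlgebra F L] [LieRing G] [LieAlgebra F G]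
  [AddCommGroup M] [Module F M]

theorem restrict_d (σ : G →ₗ⁅F⁆ Module.End F M) (j : L →ₗ⁅F⁆ G) : ∀ (n : ℕ)
    (f : G [⋀^Fin n]→ₗ[F] M),
    restrict (j : L →ₗ[F] G) (n + 1) (d σ n f) = d (σ.comp j) n (restrict (j : L →ₗ[F] G) n f)
  | 0, f => by
    refine ext_curryLeft fun x => ?_
    rw [curryLeft_restrict, curryLeft_d_zero, curryLeft_d_zero, lieTheta, lieTheta,
      restrict_theta (D := LieAlgebra.ad F L x) (by simp)]
    rfl
  | n + 1, f => by
    refine ext_curryLeft fun x => ?_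
    rw [curryLeft_restrict, curryLeft_d_succ, curryLeft_d_succ, lieTheta, lieTheta, map_sub,
      restrict_theta (D := LieAlgebra.ad F L x) (by simp), restrict_d σ j n, curryLeft_restrict]
    rfl

variable (ρ : L →ₗ⁅F⁆ Module.End F M)

/-- Betti numbers. -/
noncomputable def betti (n : ℕ) : ℕ := Module.finrank F (Cohomology ρ n)

theorem finrank_coboundaries_zero : Module.finrank F (coboundaries ρ 0) = 0 :=
  finrank_bot F _

section
variable [FiniteDimensional F L] [FiniteDimensional F M]

theorem betti_add_finrank_coboundaries (n : ℕ) :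
    betti ρ n + Module.finrank F (coboundaries ρ n) = Module.finrank F (cocycles ρ n) := by
  have h := Submodule.finrank_quotient_add_finrank
    ((coboundaries ρ n).submoduleOf (cocycles ρ n))
  rwa [(Submodule.submoduleOfEquivOfLe (coboundaries_le_cocycles ρ n)).finrank_eq] at h

theorem finrank_coboundaries_succ_add (n : ℕ) :
    Module.finrank F (coboundaries ρ (n + 1)) + Module.finrank F (cocycles ρ n) =
      Module.finrank F (L [⋀^Fin n]→ₗ[F] M) :=
  LinearMap.finrank_range_add_finrank_ker (d ρ n)

end

theorem betti_eq_of_bijective [FiniteDimensional F L] [FiniteDimensional F G]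
    [FiniteDimensional F M] (σ : G →ₗ⁅F⁆ Module.End F M) (j : L →ₗ⁅F⁆ G)
    (hj : Function.Bijective j) (n : ℕ) : betti σ n = betti (σ.comp j) n := by
  have hr : ∀ n, Function.Bijective (restrict (M := M) (j : L →ₗ[F] G) n) := by
    intro n
    let e := LinearEquiv.ofBijective (j : L →ₗ[F] G) hj
    refine Function.bijective_iff_has_inverse.2 ⟨restrict e.symm.toLinearMap n, fun f => ?_,
      fun f => ?_⟩
    · ext v
      exact congrArg f (funext fun i => e.apply_symm_apply (v i))
    · ext v
      exact congrArg f (funext fun i => e.symm_apply_apply (v i))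
  have hc : ∀ n, Module.finrank F (G [⋀^Fin n]→ₗ[F] M) = Module.finrank F (L [⋀^Fin n]→ₗ[F] M) :=
    fun n => (LinearEquiv.ofBijective _ (hr n)).finrank_eq
  have hz : ∀ n, Module.finrank F (cocycles σ n) = Module.finrank F (cocycles (σ.comp j) n) := by
    intro n
    have : cocycles σ n = (cocycles (σ.comp j) n).comap
        (LinearEquiv.ofBijective _ (hr n) : (G [⋀^Fin n]→ₗ[F] M) →ₗ[F] L [⋀^Fin n]→ₗ[F] M) := by
      ext f
      change d σ n f = 0 ↔ d (σ.comp j) n (restrict (j : L →ₗ[F] G) n f) = 0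
      rw [← restrict_d, (injective_iff_map_eq_zero' _).1 (hr (n + 1)).1]
    rw [this, Submodule.comap_equiv_eq_map_symm, LinearEquiv.finrank_map_eq]
  have h1 := betti_add_finrank_coboundaries σ n
  have h2 := betti_add_finrank_coboundaries (σ.comp j) n
  cases n with
  | zero =>
    rw [finrank_coboundaries_zero] at h1 h2
    have := hz 0
    omega
  | succ n =>
    have h3 := finrank_coboundaries_succ_add σ n
    have h4 := finrank_coboundaries_succ_add (σ.comp j) n
    have := hz n
    have := hz (n + 1)
    have := hc n
    omega

/-- The Betti numbers of an extension of `L` by a derivation that acts trivially on the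
cohomology of `L`. -/
theorem betti_of_actsTrivially [FiniteDimensional F L] [FiniteDimensional F G]
    [FiniteDimensional F M] (σ : G →ₗ⁅F⁆ Module.End F M) (j : L →ₗ⁅F⁆ G) {x : G}
    {D : Module.End F L} (hD : ∀ y, j (D y) = ⁅x, j y⁆)
    (htriv : ActsTrivially (σ.comp j) D (σ x))
    {π : G →ₗ[F] L} {ξ : G →ₗ[F] F}
    (hπj : ∀ y, π (j y) = y) (hξj : ∀ y, ξ (j y) = 0) (hπx : π x = 0) (hξx : ξ x = 1)
    (hx : ∀ y, ∃ (a : L) (c : F), y = j a + c • x) :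
    betti σ 0 = betti (σ.comp j) 0 ∧
      ∀ n, betti σ (n + 1) = betti (σ.comp j) (n + 1) + betti (σ.comp j) n := by
  let E := fun n => splitEquiv (M := M) (j : L →ₗ[F] G) x π ξ hπj hξj hπx hξx hx n
  have hr0 : Function.Bijective (restrict (M := M) (j : L →ₗ[F] G) 0) := by
    refine Function.bijective_iff_has_inverse.2 ⟨restrict π 0, fun f => ?_, fun f => ?_⟩ <;>
    · ext v
      exact congrArg f (Subsingleton.elim _ _)
  have hc0 : Module.finrank F (G [⋀^Fin 0]→ₗ[F] M) = Module.finrank F (L [⋀^Fin 0]→ₗ[F] M) :=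
    (LinearEquiv.ofBijective _ hr0).finrank_eq
  have hc : ∀ n, Module.finrank F (G [⋀^Fin (n + 1)]→ₗ[F] M) =
      Module.finrank F (L [⋀^Fin (n + 1)]→ₗ[F] M) + Module.finrank F (L [⋀^Fin n]→ₗ[F] M) := by
    intro n
    rw [(E n).finrank_eq, Module.finrank_prod]
  -- `d f` vanishes exactly when both its components do. For `f` with components `(a, b)` they are
  -- `d a` and `θ a - d b`, where `θ` is the operator of the pair `(D, σ x)`.
  have hd : ∀ n f, f ∈ cocycles σ n ↔ restrict (j : L →ₗ[F] G) n f ∈ cocycles (σ.comp j) n ∧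
      restrict (j : L →ₗ[F] G) n ((d σ n f).curryLeft x) = 0 := by
    intro n f
    change d σ n f = 0 ↔ d (σ.comp j) n _ = 0 ∧ _
    rw [← restrict_d]
    refine ⟨fun h => ?_, fun h => eq_zero_of_restrict_eq_zero (j := (j : L →ₗ[F] G)) hx h.1 h.2⟩
    rw [h]
    exact ⟨map_zero _, by rw [AlternatingMap.curryLeft_zero, LinearMap.zero_apply, map_zero]⟩
  have hz0 : Module.finrank F (cocycles σ 0) = Module.finrank F (cocycles (σ.comp j) 0) := by
    have : cocycles σ 0 = (cocycles (σ.comp j) 0).comap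
        (LinearEquiv.ofBijective _ hr0 : (G [⋀^Fin 0]→ₗ[F] M) →ₗ[F] L [⋀^Fin 0]→ₗ[F] M) := by
      ext f
      rw [hd]
      refine ⟨fun h => h.1, fun h => ⟨h, ?_⟩⟩
      rw [curryLeft_d_zero, lieTheta, restrict_theta (D := D) hD]
      -- Membership in the zero space of `0`-coboundaries is the required equation.
      exact htriv 0 _ h
    rw [this, Submodule.comap_equiv_eq_map_symm, LinearEquiv.finrank_map_eq]
  have hz : ∀ n, Module.finrank F (cocycles σ (n + 1)) =
      Module.finrank F (cocycles (σ.comp j) (n + 1)) +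
        Module.finrank F (cocycles (σ.comp j) n) := by
    intro n
    -- Triviality makes `θ a` a coboundary for every cocycle `a`, so a linear section of `d` gives
    -- `t` with `d (t a) = θ a`. The condition `d b = θ a` then says that `b - t a` is a cocycle,
    -- and the cocycles of `G` are parametrized by pairs of cocycles.
    obtain ⟨s, hs⟩ := LinearMap.exists_rightInverse_of_surjective (d (σ.comp j) n).rangeRestrict
      (LinearMap.range_rangeRestrict _)
    let t : cocycles (σ.comp j) (n + 1) →ₗ[F] L [⋀^Fin n]→ₗ[F] M :=
      s.comp (((theta D (σ x) (n + 1)).comp (Submodule.subtype _)).codRestrict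
        (LinearMap.range (d (σ.comp j) n)) fun a => htriv (n + 1) a a.2)
    have ht : ∀ a, d (σ.comp j) n (t a) = theta D (σ x) (n + 1) a := by
      intro a
      exact congrArg Subtype.val (LinearMap.congr_fun hs _)
    let Φ : (cocycles (σ.comp j) (n + 1) × cocycles (σ.comp j) n) →ₗ[F]
        (L [⋀^Fin (n + 1)]→ₗ[F] M) × (L [⋀^Fin n]→ₗ[F] M) :=
      ((Submodule.subtype _).comp (LinearMap.fst F _ _)).prod
        (t.comp (LinearMap.fst F _ _) + (Submodule.subtype _).comp (LinearMap.snd F _ _))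
    have hΦ : ∀ a b, Φ (a, b) = (a.1, t a + b.1) := fun _ _ => rfl
    have hinj : Function.Injective Φ := by
      rintro ⟨a, b⟩ ⟨a', b'⟩ h
      rw [hΦ, hΦ, Prod.mk.injEq] at h
      obtain rfl := Subtype.ext h.1
      obtain rfl := Subtype.ext (add_left_cancel h.2)
      rfl
    have : cocycles σ (n + 1) = (LinearMap.range Φ).comap
        (E n : (G [⋀^Fin (n + 1)]→ₗ[F] M) →ₗ[F] _) := by
      ext f
      rw [hd, curryLeft_d_succ, map_sub, restrict_d, lieTheta, restrict_theta (D := D) hD,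
        sub_eq_zero]
      change _ ↔ (_, _) ∈ LinearMap.range Φ
      constructor
      · rintro ⟨h1, h2⟩
        refine ⟨(⟨_, h1⟩, ⟨restrict (j : L →ₗ[F] G) n (f.curryLeft x) - t ⟨_, h1⟩, ?_⟩), ?_⟩
        · change d (σ.comp j) n _ = 0
          rw [map_sub, ht, sub_eq_zero]
          exact h2.symm
        · rw [hΦ]
          exact Prod.ext rfl (add_sub_cancel _ _)
      · rintro ⟨⟨a, b⟩, h⟩
        rw [hΦ, Prod.mk.injEq] at h
        have hb : d (σ.comp j) n b = 0 := b.2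
        have h1 : a.1 = restrict (j : L →ₗ[F] G) (n + 1) f := h.1
        have h2 : t a + b.1 = restrict (j : L →ₗ[F] G) n (f.curryLeft x) := h.2
        refine ⟨h1 ▸ a.2, ?_⟩
        rw [← h2, map_add, ht, hb, add_zero, h1]
    rw [this, Submodule.comap_equiv_eq_map_symm, LinearEquiv.finrank_map_eq,
      LinearMap.finrank_range_of_inj hinj, Module.finrank_prod]
  -- Betti numbers are determined by the dimensions of cochains and cocycles, and both satisfy the
  -- required recursion; the rest is arithmetic.
  have hG := betti_add_finrank_coboundaries σ
  have hL := betti_add_finrank_coboundaries (σ.comp j)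
  have hG' := finrank_coboundaries_succ_add σ
  have hL' := finrank_coboundaries_succ_add (σ.comp j)
  have hG0 := finrank_coboundaries_zero σ
  have hL0 := finrank_coboundaries_zero (σ.comp j)
  refine ⟨?_, fun n => ?_⟩
  · have := hG 0
    have := hL 0
    omega
  · have h1 := hG (n + 1)
    have h2 := hL (n + 1)
    have h3 := hL n
    have h4 := hz n
    have h5 := hG' n
    have h6 := hL' n
    cases n with
    | zero => omega
    | succ n =>
      have := hL' n
      have := hz n
      have := hc n
      omega

end Dimension

end ChevalleyEilenberg

/-! ### Restricted subalgebras and the derived algebra of a `p`-envelope -/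

theorem ad_pow_char_apply {F A : Type*} [Field F] [Ring A] [Algebra F A] (p : ℕ) [Fact p.Prime]
    [CharP F p] (u v : A) : (LieAlgebra.ad F A u ^ p) v = ⁅u ^ p, v⁆ := by
  have h : LieAlgebra.ad F A u ^ p = LieAlgebra.ad F A (u ^ p) := by
    -- `ad u` is left minus right multiplication by `u`, and these commute.
    rw [LieAlgebra.ad_eq_lmul_left_sub_lmul_right]
    change (LinearMap.mulLeft F u - LinearMap.mulRight F u) ^ p =
      LinearMap.mulLeft F (u ^ p) - LinearMap.mulRight F (u ^ p)
    rw [sub_pow_of_commute_of_charP (F := F) p (LinearMap.commute_mulLeft_right u u),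
      LinearMap.pow_mulLeft, LinearMap.pow_mulRight]
  rw [h, LieAlgebra.ad_apply]

theorem restrictedSpan_le {F L : Type*} [Field F] [LieRing L] [LieAlgebra F L] {P : L → L}
    {S : Set L} {H : LieSubalgebra F L} (hS : S ⊆ H) (hP : ∀ x ∈ H, P x ∈ H) :
    restrictedSpan P S ≤ H := by
  intro x hx
  rw [restrictedSpan, ← SetLike.mem_coe, LieSubalgebra.coe_sInf] at hx
  exact Set.mem_iInter₂.1 hx H ⟨hS, hP⟩

/-- The subalgebra of all elements `y` such that `[y, V] ⊆ W`, where `W ⊆ V`. -/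
def lieTransporter {F L : Type*} [Field F] [LieRing L] [LieAlgebra F L] (V W : Submodule F L)
    (h : W ≤ V) : LieSubalgebra F L where
  carrier := {y | ∀ z ∈ V, ⁅y, z⁆ ∈ W}
  add_mem' {a b} ha hb z hz := by
    rw [add_lie]
    exact add_mem (ha z hz) (hb z hz)
  zero_mem' z hz := by
    rw [zero_lie]
    exact zero_mem _
  smul_mem' c a ha z hz := by
    rw [smul_lie]
    exact W.smul_mem c (ha z hz)
  lie_mem' {a b} ha hb z hz := by
    rw [lie_lie]
    exact sub_mem (ha _ (h (hb z hz))) (hb _ (h (ha z hz)))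

/-- `ad (y^[p])` is `(ad y) ^ p`, and since `p ≥ 1` and `W ≤ V`, iterating `ad y` stays in `W`. -/
theorem PMapping.toFun_mem_lieTransporter {p : ℕ} [Fact p.Prime] {F L : Type*} [Field F]
    [LieRing L] [LieAlgebra F L] (P : PMapping p F L) {V W : Submodule F L} {h : W ≤ V} {y : L}
    (hy : y ∈ lieTransporter V W h) : P.toFun y ∈ lieTransporter V W h := by
  intro z hz
  rw [← LieAlgebra.ad_apply (R := F), P.ad_toFun]
  have key : ∀ k, (LieAlgebra.ad F L y ^ (k + 1)) z ∈ W := by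
    intro k
    induction k with
    | zero => simpa using hy z hz
    | succ k ih =>
      rw [pow_succ', Module.End.mul_apply]
      exact hy _ (h ih)
  obtain ⟨k, hk⟩ := Nat.exists_eq_succ_of_ne_zero (Fact.out : p.Prime).ne_zero
  rw [hk]
  exact key k

/-- The derived algebra of a `p`-envelope of `L` is contained in `L`. -/
theorem IsPEnvelope.lie_mem_range {p : ℕ} [Fact p.Prime] {F L E : Type*} [Field F] [LieRing L]
    [LieAlgebra F L] [LieRing E] [LieAlgebra F E] {P : PMapping p F E} {ι : L →ₗ⁅F⁆ E}
    (h : IsPEnvelope P ι) (x y : E) : ⁅x, y⁆ ∈ ι.range.toSubmodule := by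
  have top : ∀ {V W : Submodule F E} {hVW : W ≤ V},
      (∀ a, ι a ∈ lieTransporter V W hVW) → ∀ x, x ∈ lieTransporter V W hVW := by
    intro V W hVW hι x
    have hx : x ∈ restrictedSpan (F := F) P.toFun (Set.range ι) := by
      rw [h.restrictedSpan_eq_top]
      exact LieSubalgebra.mem_top x
    refine restrictedSpan_le ?_ (fun y hy => P.toFun_mem_lieTransporter hy) hx
    rintro _ ⟨a, rfl⟩
    exact hι a
  -- The normalizer of `L` contains `L` and is closed under the `p`-mapping, so `L` is an ideal.
  have h1 : ∀ x, x ∈ lieTransporter ι.range.toSubmodule ι.range.toSubmodule le_rfl := by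
    refine top fun a => ?_
    rintro _ ⟨b, rfl⟩
    exact ⟨⁅a, b⁆, ι.map_lie a b⟩
  -- Since `L` is an ideal, it lies in the subalgebra of elements that bracket all of `E` into `L`;
  -- this is again closed under the `p`-mapping.
  have h2 : ∀ x, x ∈ lieTransporter ⊤ ι.range.toSubmodule le_top := by
    refine top fun a => ?_
    intro z _
    rw [← lie_skew]
    exact neg_mem (h1 z _ ⟨a, rfl⟩)
  exact h2 x y trivial

/-! ### Triviality of the action and the Poincaré series -/

namespace ChevalleyEilenberg

section

variable {p : ℕ} [Fact p.Prime] {F : Type*} [Field F] [CharP F p]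
  {L : Type*} [LieRing L] [LieAlgebra F L]
  {M : Type*} [AddCommGroup M] [Module F M] (ρ : L →ₗ⁅F⁆ Module.End F M)
  {G : Type*} [LieRing G] [LieAlgebra F G]

/-- The representation that a homomorphism into the universal enveloping algebra of `L` and a
representation of `L` define. -/
noncomputable def pullback (ψ : G →ₗ⁅F⁆ UniversalEnvelopingAlgebra F L) :
    G →ₗ⁅F⁆ Module.End F M :=
  ((UniversalEnvelopingAlgebra.lift F ρ : UniversalEnvelopingAlgebra F L →ₐ[F] Module.End F M) :
    UniversalEnvelopingAlgebra F L →ₗ⁅F⁆ Module.End F M).comp ψ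

theorem pullback_apply (ψ : G →ₗ⁅F⁆ UniversalEnvelopingAlgebra F L) (x : G) :
    pullback ρ ψ x = UniversalEnvelopingAlgebra.lift F ρ (ψ x) := rfl

variable {j : L →ₗ⁅F⁆ G} {ψ : G →ₗ⁅F⁆ UniversalEnvelopingAlgebra F L}

/-- The elements of `U(L)` that act on `G` by an endomorphism with values in `L` such that the
action on cohomology is trivial. -/
def trivialElements (j : L →ₗ⁅F⁆ G) (ψ : G →ₗ⁅F⁆ UniversalEnvelopingAlgebra F L) :
    LieSubalgebra F (UniversalEnvelopingAlgebra F L) where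
  carrier := {u | ∃ D : Module.End F G, (∀ z, D z ∈ j.range.toSubmodule) ∧
    (∀ z, ψ (D z) = ⁅u, ψ z⁆) ∧
    ActsTrivially (pullback ρ ψ) D (UniversalEnvelopingAlgebra.lift F ρ u)}
  add_mem' := by
    rintro u u' ⟨D, h1, h2, h3⟩ ⟨D', h1', h2', h3'⟩
    refine ⟨D + D', fun z => add_mem (h1 z) (h1' z), fun z => ?_, ?_⟩
    · rw [LinearMap.add_apply, map_add, h2, h2', add_lie]
    · rw [map_add]
      exact h3.add h3'
  zero_mem' := by
    refine ⟨0, fun z => zero_mem _, fun z => ?_, ?_⟩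
    · rw [LinearMap.zero_apply, map_zero, zero_lie]
    · rw [map_zero]
      exact actsTrivially_zero
  smul_mem' := by
    rintro c u ⟨D, h1, h2, h3⟩
    refine ⟨c • D, fun z => Submodule.smul_mem _ c (h1 z), fun z => ?_, ?_⟩
    · rw [LinearMap.smul_apply, map_smul, h2, smul_lie]
    · rw [map_smul]
      exact h3.smul c
  lie_mem' := by
    rintro u u' ⟨D, h1, h2, h3⟩ ⟨D', h1', h2', h3'⟩
    refine ⟨D * D' - D' * D, fun z => sub_mem (h1 _) (h1' _), fun z => ?_, ?_⟩
    · rw [LinearMap.sub_apply, map_sub, Module.End.mul_apply, Module.End.mul_apply, h2, h2', h2',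
        h2, lie_lie]
    · have : UniversalEnvelopingAlgebra.lift F ρ ⁅u, u'⁆ =
          UniversalEnvelopingAlgebra.lift F ρ u * UniversalEnvelopingAlgebra.lift F ρ u' -
          UniversalEnvelopingAlgebra.lift F ρ u' * UniversalEnvelopingAlgebra.lift F ρ u := by
        rw [LieRing.of_associative_ring_bracket, map_sub, map_mul, map_mul]
      rw [this]
      exact h3.commutator h3'

variable (p)

/-- Minimality of the universal `p`-envelope. Elements of `L` are trivial by Cartan's formula, and
if `D` serves `u`, then `D ^ p` serves `u ^ p`, because `(ad u) ^ p = ad (u ^ p)` and by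
`ActsTrivially.pow_char`. -/
theorem universalPEnvelope_le_trivialElements (hj : ∀ x y : G, ⁅x, y⁆ ∈ j.range.toSubmodule)
    (hψj : ∀ x, ψ (j x) = UniversalEnvelopingAlgebra.ι F x) :
    UniversalPEnvelope p F L ≤ trivialElements ρ j ψ := by
  refine restrictedSpan_le ?_ ?_
  · rintro _ ⟨x, rfl⟩
    refine ⟨LieAlgebra.ad F G (j x), fun z => hj _ _, fun z => ?_, ?_⟩
    · rw [LieAlgebra.ad_apply, LieHom.map_lie, hψj]
    · rw [← hψj]
      exact actsTrivially_ad _ _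
  · rintro u ⟨D, h1, h2, h3⟩
    refine ⟨D ^ p, fun z => ?_, fun z => ?_, ?_⟩
    · obtain ⟨k, hk⟩ := Nat.exists_eq_succ_of_ne_zero (Fact.out : p.Prime).ne_zero
      rw [hk, pow_succ']
      exact h1 _
    · rw [← ad_pow_char_apply (F := F) p]
      have key : ∀ k, ψ ((D ^ k) z) = (LieAlgebra.ad F _ u ^ k) (ψ z) := by
        intro k
        induction k with
        | zero => simp
        | succ k ih =>
          rw [pow_succ', pow_succ', Module.End.mul_apply, Module.End.mul_apply, h2, ih,
            LieAlgebra.ad_apply]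
      exact key p
    · rw [map_pow]
      exact h3.pow_char p

/-- Triviality is known for some endomorphism attached to `u`, but there is only one: `ψ ∘ D` is
prescribed, `D` takes values in `L`, and `ψ` is injective on `L` by Poincaré–Birkhoff–Witt. -/
theorem actsTrivially_of_mem_universalPEnvelope
    (hj : ∀ x y : G, ⁅x, y⁆ ∈ j.range.toSubmodule)
    (hψj : ∀ x, ψ (j x) = UniversalEnvelopingAlgebra.ι F x)
    {u : UniversalEnvelopingAlgebra F L} (hu : u ∈ UniversalPEnvelope p F L)
    {D : Module.End F G} (hD : ∀ z, D z ∈ j.range.toSubmodule) (hψD : ∀ z, ψ (D z) = ⁅u, ψ z⁆) :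
    ActsTrivially (pullback ρ ψ) D (UniversalEnvelopingAlgebra.lift F ρ u) := by
  obtain ⟨D', h1, h2, h3⟩ := universalPEnvelope_le_trivialElements p ρ hj hψj hu
  have : D' = D := by
    ext z
    obtain ⟨a, ha⟩ := h1 z
    obtain ⟨b, hb⟩ := hD z
    have ha' : j a = D' z := ha
    have hb' : j b = D z := hb
    have h := (h2 z).trans (hψD z).symm
    rw [← ha', ← hb', hψj, hψj] at h
    rw [← ha', ← hb', UniversalEnvelopingAlgebra.ι_injective h]
  rwa [this] at h3

/-- The Poincaré series of the cohomology. -/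
noncomputable def poincareSeries (σ : G →ₗ⁅F⁆ Module.End F M) : PowerSeries ℤ :=
  PowerSeries.mk fun n => (betti σ n : ℤ)

end

/-- Induction on the codimension of `L` in `G`. Intermediate algebras need not be restricted, so the
`p`-envelope enters only through conditions that subalgebras containing `L` inherit: brackets lie in
`L`, and `ψ` takes values in the universal `p`-envelope. -/
theorem poincareSeries_pullback (p : ℕ) [Fact p.Prime] {F : Type*} [Field F] [CharP F p]
    {L : Type*} [LieRing L] [LieAlgebra F L] [FiniteDimensional F L]
    {M : Type*} [AddCommGroup M] [Module F M] [FiniteDimensional F M]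
    (ρ : L →ₗ⁅F⁆ Module.End F M) (k : ℕ) :
    ∀ (G : Type*) [LieRing G] [LieAlgebra F G] [FiniteDimensional F G] (j : L →ₗ⁅F⁆ G)
      (ψ : G →ₗ⁅F⁆ UniversalEnvelopingAlgebra F L), Function.Injective j →
      (∀ x y : G, ⁅x, y⁆ ∈ j.range.toSubmodule) →
      (∀ x, ψ (j x) = UniversalEnvelopingAlgebra.ι F x) →
      (∀ x, ψ x ∈ UniversalPEnvelope p F L) →
      Module.finrank F G = Module.finrank F L + k →
      poincareSeries (pullback ρ ψ) = (1 + PowerSeries.X) ^ k * poincareSeries ρ := by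
  induction k with
  | zero =>
    intro G _ _ _ j ψ hinj _ hψj _ hk
    have hbij : Function.Bijective j :=
      ⟨hinj, (LinearMap.injective_iff_surjective_of_finrank_eq_finrank
        (f := (j : L →ₗ[F] G)) (by simpa using hk.symm)).1 hinj⟩
    have hρ : (pullback ρ ψ).comp j = ρ := by
      ext1 x
      rw [LieHom.comp_apply, pullback_apply, hψj, UniversalEnvelopingAlgebra.lift_ι_apply]
    rw [pow_zero, one_mul]
    ext n
    rw [poincareSeries, poincareSeries, PowerSeries.coeff_mk, PowerSeries.coeff_mk,
      betti_eq_of_bijective _ j hbij, hρ]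
  | succ k ih =>
    intro G _ _ _ j ψ hinj hj hψj hψ hk
    have hlt : j.range.toSubmodule < ⊤ := by
      refine lt_top_iff_ne_top.2 fun h => ?_
      have h1 := LinearMap.finrank_range_of_inj (f := (j : L →ₗ[F] G)) hinj
      have h2 : LinearMap.range (j : L →ₗ[F] G) = ⊤ := h
      rw [h2, finrank_top] at h1
      omega
    -- A hyperplane containing `L` is an ideal because brackets lie in `L`; `x` is a complement
    -- normalized by `ξ x = 1`.
    obtain ⟨ξ, hξ0, hξ⟩ := Submodule.exists_le_ker_of_lt_top _ hlt
    obtain ⟨x, hξx⟩ : ∃ x, ξ x = 1 := by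
      obtain ⟨y, hy⟩ := DFunLike.ne_iff.1 hξ0
      exact ⟨(ξ y)⁻¹ • y, by simpa using inv_mul_cancel₀ hy⟩
    let H : LieSubalgebra F G := { LinearMap.ker ξ with lie_mem' := fun {a b} _ _ => hξ (hj a b) }
    have hmem : ∀ {y}, y ∈ H ↔ ξ y = 0 := Iff.rfl
    have hHrank : Module.finrank F H = Module.finrank F L + k := by
      have h1 := LinearMap.finrank_range_add_finrank_ker ξ
      have h2 : LinearMap.range ξ = ⊤ :=
        LinearMap.range_eq_top.2 fun c => ⟨c • x, by rw [map_smul, hξx, smul_eq_mul, mul_one]⟩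
      rw [h2, finrank_top, Module.finrank_self] at h1
      have h3 : Module.finrank F H = Module.finrank F (LinearMap.ker ξ) := rfl
      omega
    have hjH : ∀ a, j a ∈ H := fun a => hξ ⟨a, rfl⟩
    let j' : L →ₗ⁅F⁆ H :=
      { toFun := fun a => ⟨j a, hjH a⟩
        map_add' := fun a b => Subtype.ext (map_add j a b)
        map_smul' := fun c a => Subtype.ext (map_smul j c a)
        map_lie' := fun {a b} => Subtype.ext (j.map_lie a b) }
    have hj' : ∀ {y : H}, (y : G) ∈ j.range.toSubmodule → y ∈ j'.range.toSubmodule := by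
      rintro y ⟨a, ha⟩
      exact ⟨a, Subtype.ext ha⟩
    let D : Module.End F H :=
      { toFun := fun y => ⟨⁅x, (y : G)⁆, hξ (hj _ _)⟩
        map_add' := fun a b => Subtype.ext (lie_add x _ _)
        map_smul' := fun c a => Subtype.ext (lie_smul c x _) }
    let π : G →ₗ[F] H :=
      { toFun := fun y => ⟨y - ξ y • x, by rw [hmem, map_sub, map_smul, hξx, smul_eq_mul, mul_one,
          sub_self]⟩
        map_add' := fun a b => Subtype.ext (by
          change a + b - ξ (a + b) • x = a - ξ a • x + (b - ξ b • x)
          rw [map_add, add_smul]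
          abel)
        map_smul' := fun c a => Subtype.ext (by
          change c • a - ξ (c • a) • x = c • (a - ξ a • x)
          rw [map_smul, smul_sub, smul_assoc]) }
    -- The uniqueness result is applied to the algebra `H` and `u = ψ x`, an element coming from
    -- outside `H`.
    have htriv : ActsTrivially ((pullback ρ ψ).comp H.incl) D (pullback ρ ψ x) :=
      actsTrivially_of_mem_universalPEnvelope p ρ (j := j') (ψ := ψ.comp H.incl)
        (fun a b => hj' (hj a b)) hψj (hψ x) (fun z => hj' (hj _ _)) (fun z => ψ.map_lie x z)
    obtain ⟨h0, hs⟩ := betti_of_actsTrivially (pullback ρ ψ) H.incl (x := x) (D := D) (π := π)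
      (ξ := ξ) (fun y => rfl) htriv
      (fun y => Subtype.ext (by
        change (y : G) - ξ y • x = y
        rw [hmem.1 y.2, zero_smul, sub_zero]))
      (fun y => hmem.1 y.2)
      (Subtype.ext (by
        change x - ξ x • x = 0
        rw [hξx, one_smul, sub_self]))
      hξx (fun y => ⟨π y, ξ y, (sub_add_cancel y (ξ y • x)).symm⟩)
    have hH := ih H j' (ψ.comp H.incl) (fun a b h => hinj (congrArg Subtype.val h))
      (fun a b => hj' (hj a b)) hψj (fun y => hψ y) hHrank
    rw [pow_succ', mul_assoc, ← hH]
    ext n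
    rw [add_mul, one_mul, map_add]
    cases n with
    | zero =>
      rw [PowerSeries.coeff_zero_X_mul, poincareSeries, poincareSeries, PowerSeries.coeff_mk,
        PowerSeries.coeff_mk, h0, add_zero]
      rfl
    | succ n =>
      rw [PowerSeries.coeff_succ_X_mul, poincareSeries, poincareSeries, PowerSeries.coeff_mk,
        PowerSeries.coeff_mk, PowerSeries.coeff_mk, hs, Nat.cast_add]
      rfl

end ChevalleyEilenberg

/-! ### Generating functions of binomial coefficients and the theorem -/

/-- The signed shifted binomial coefficients are the coefficients of `(1 + X)⁻ᵏ`. -/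
theorem mk_shiftedChoose_mul (k : ℕ) :
    (PowerSeries.mk fun ν => (-1 : ℤ) ^ ν * (shiftedChoose ν k : ℤ)) *
      (1 + PowerSeries.X) ^ k = 1 := by
  cases k with
  | zero =>
    rw [pow_zero, mul_one]
    ext n
    rw [PowerSeries.coeff_mk, PowerSeries.coeff_one]
    by_cases h : n = 0 <;> simp [shiftedChoose, h]
  | succ k =>
    -- Substitution of `-X` for `X` in the expansion of `(1 - X)⁻⁽ᵏ⁺¹⁾`.
    have h := congrArg (PowerSeries.rescale (-1 : ℤ))
      (PowerSeries.mk_add_choose_mul_one_sub_pow_eq_one ℤ k)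
    rw [map_mul, map_pow, map_sub, map_one, PowerSeries.rescale_X, PowerSeries.rescale_mk] at h
    refine Eq.trans ?_ h
    congr 1
    · ext n
      simp [shiftedChoose, Nat.add_comm]
    · simp

theorem coeff_one_add_X_pow_mul_mk (k n : ℕ) (h : ℕ → ℕ) :
    PowerSeries.coeff n ((1 + PowerSeries.X) ^ k * PowerSeries.mk fun n => (h n : ℤ)) =
      ((∑ j ∈ Finset.range (k + 1), k.choose j * if j ≤ n then h (n - j) else 0 : ℕ) : ℤ) := by
  have hc : ∀ i, PowerSeries.coeff i ((1 + PowerSeries.X : PowerSeries ℤ) ^ k) = k.choose i := by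
    intro i
    rw [← Polynomial.coeff_one_add_X_pow ℤ k i, ← Polynomial.coeff_coe]
    simp
  rw [PowerSeries.coeff_mul, Finset.Nat.sum_antidiagonal_eq_sum_range_succ_mk]
  simp only [hc, PowerSeries.coeff_mk]
  push_cast
  let g : ℕ → ℤ := fun i => (k.choose i : ℤ) * if i ≤ n then (h (n - i) : ℤ) else 0
  -- Both ranges are enlarged to `n + k + 1`: beyond `n` the conditional vanishes, beyond `k` the
  -- binomial coefficient.
  calc ∑ i ∈ Finset.range (n + 1), (k.choose i : ℤ) * (h (n - i) : ℤ)
      = ∑ i ∈ Finset.range (n + 1), g i := Finset.sum_congr rfl fun i hi => by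
        simp only [g, if_pos (Nat.lt_succ_iff.1 (Finset.mem_range.1 hi))]
    _ = ∑ i ∈ Finset.range (n + k + 1), g i :=
        Finset.sum_subset (Finset.range_mono (by omega)) fun i _ hi => by
          rw [Finset.mem_range] at hi
          simp only [g, if_neg (show ¬i ≤ n by omega), mul_zero]
    _ = ∑ i ∈ Finset.range (k + 1), g i :=
        (Finset.sum_subset (Finset.range_mono (by omega)) fun i _ hi => by
          rw [Finset.mem_range] at hi
          simp only [g, Nat.choose_eq_zero_of_lt (show k < i by omega), Nat.cast_zero,
            zero_mul]).symm

theorem mainTheorem1 {p : ℕ} [Fact p.Prime] {F : Type*} [Field F] [CharP F p]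
    {L : Type*} [LieRing L] [LieAlgebra F L] [FiniteDimensional F L]
    {M : Type*} [AddCommGroup M] [Module F M] [FiniteDimensional F M]
    (ρ : L →ₗ⁅F⁆ Module.End F M)
    {E : Type*} [LieRing E] [LieAlgebra F E]
    (P : PMapping p F E) (ι : L →ₗ⁅F⁆ E) (hE : IsPEnvelope P ι)
    (hfin : FiniteDimensional F (E ⧸ ι.range.toSubmodule))
    (k : ℕ) (hk : k = Module.finrank F (E ⧸ ι.range.toSubmodule))
    (φ : E →ₗ⁅F⁆ UniversalPEnvelope p F L) (hφ : φ.comp ι = UniversalPEnvelope.ι p F L)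
    (σ : E →ₗ⁅F⁆ Module.End F M) (hσ : σ = (UniversalPEnvelope.rep p ρ).comp φ) (n : ℕ) :
    FiniteDimensional F (ChevalleyEilenberg.Cohomology ρ n) ∧
    FiniteDimensional F (ChevalleyEilenberg.Cohomology σ n) ∧
    Module.finrank F (ChevalleyEilenberg.Cohomology σ n) =
      ∑ j ∈ Finset.range (k + 1), k.choose j *
        (if j ≤ n then Module.finrank F (ChevalleyEilenberg.Cohomology ρ (n - j)) else 0) ∧
    (Module.finrank F (ChevalleyEilenberg.Cohomology ρ n) : ℤ) =
      ∑ ν ∈ Finset.range (n + 1), (-1 : ℤ) ^ ν * (shiftedChoose ν k : ℤ) *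
        (Module.finrank F (ChevalleyEilenberg.Cohomology σ (n - ν)) : ℤ) := by
  have hrange : FiniteDimensional F ι.range.toSubmodule :=
    inferInstanceAs (FiniteDimensional F (LinearMap.range (ι : L →ₗ[F] E)))
  have hEfin : FiniteDimensional F E := Module.Finite.of_submodule_quotient ι.range.toSubmodule
  have hrank : Module.finrank F E = Module.finrank F L + k := by
    rw [hk, ← Submodule.finrank_quotient_add_finrank ι.range.toSubmodule, add_comm]
    congr 1
    exact LinearMap.finrank_range_of_inj (f := (ι : L →ₗ[F] E)) hE.injective
  have hseries : ChevalleyEilenberg.poincareSeries σ =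
      (1 + PowerSeries.X) ^ k * ChevalleyEilenberg.poincareSeries ρ := by
    rw [hσ]
    exact ChevalleyEilenberg.poincareSeries_pullback p ρ k E ι
      ((UniversalPEnvelope p F L).incl.comp φ) hE.injective hE.lie_mem_range
      (fun x => congrArg Subtype.val (LieHom.congr_fun hφ x)) (fun x => (φ x).2) hrank
  refine ⟨inferInstance, inferInstance, ?_, ?_⟩
  · have h := congrArg (PowerSeries.coeff n) hseries
    rw [ChevalleyEilenberg.poincareSeries, ChevalleyEilenberg.poincareSeries,
      coeff_one_add_X_pow_mul_mk, PowerSeries.coeff_mk] at h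
    exact_mod_cast h
  -- Multiplication by the inverse of `(1 + X)ᵏ` expresses the series of `ρ` through that of `σ`.
  · have h := congrArg (fun s => (PowerSeries.mk fun ν => (-1 : ℤ) ^ ν * (shiftedChoose ν k : ℤ)) * s)
      hseries
    simp only [← mul_assoc, mk_shiftedChoose_mul, one_mul] at h
    have h' := congrArg (PowerSeries.coeff n) h
    rw [PowerSeries.coeff_mul, Finset.Nat.sum_antidiagonal_eq_sum_range_succ_mk] at h'
    simp only [ChevalleyEilenberg.poincareSeries, PowerSeries.coeff_mk] at h'
    exact h'.symm
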